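/- Let $A$ be a noetherian commutative ring and $R=\bigoplus_{a,b\ge 0}R_{a,b}$ a bihomogeneous $A$-algebra, that is, a commutative bigraded $A$-algebra with $R_{0,0}=A$ that is generated over $A$ by finitely many homogeneous elements of bidegrees $(1,0)$ and $(0,1)$. Let $\mathfrak m=\bigoplus_{a>0,\,b>0}R_{a,b}$ be the irrelevant ideal, let $M=\bigoplus_{(a,b)\in\mathbb Z^2}M_{a,b}$ be a finitely generated bigraded $R$-module, and let $H^i_{\mathfrak m}(M)_{k,k'}$ be the part of bidegree $(k,k')$ of the bigraded local cohomology module $H^i_{\mathfrak m}(M)=\varinjlim_n \mathrm{Ext}^i_R(R/\mathfrak m^n,M)$. Let $\mathbb Z_+=\{n\in\mathbb Z: n\ge 0\}$. For $i>0$ let $St_i=\{(r,s)\in\mathbb Z^2: r+s=-i-1,\ r<0,\ s<0\}$; for $i\le 0$ let $St_i=\{(r,s)\in\mathbb Z^2: r+s=-i,\ r\ge 0,\ s\ge 0\}$. For $(p,p')\in\mathbb Z^2$ put $St_i(p,p')=(p,p')+St_i$; $Reg_i(p,p')=\mathbb Z_+^2+St_i(p,p')$ for $i\ge 0$; $Reg_{-1}(p,p')=(p+1,p'+1)+\mathbb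 Z_+^2$; $Reg'_{-1}(p,p')=(p+1,p')+\mathbb Z_+^2$; $Reg''_{-1}(p,p')=(p,p'+1)+\mathbb Z_+^2$. The module $M$ is called weakly $(p,p')$-regular if $H^i_{\mathfrak m}(M)_{k,k'}=0$ for all $i\ge 0$ and all $(k,k')\in Reg_{i-1}(p,p')$. Let $R_{a,b}M_{k,k'}$ be the subgroup of $M$ generated by all products of an element of $R_{a,b}$ and an element of $M_{k,k'}$. Fix $(p,p')\in\mathbb Z^2$. 1. Suppose that $H^i_{\mathfrak m}(M)_{k,k'}=0$ for all $i\ge 1$ and all $(k,k')\in St_{i-1}(p,p')$. Then $H^i_{\mathfrak m}(M)_{k,k'}=0$ for all $i\ge 1$ and all $(k,k')\in Reg_{i-1}(p,p')$. 2. Suppose that the hypothesis of 1 holds. (a) If moreover $H^0_{\mathfrak m}(M)_{k,k'}=0$ for all $(k,k')\in Reg'_{-1}(p,p')$, then $R_{d,0}M_{k,k'}=M_{d+k,k'}$ for all $d\ge 0$, $k\ge p$, $k'\ge p'$. (b) If moreover $H^0_{\mathfrak m}(M)_{k,k'}=0$ for all $(k,k')\in Reg''_{-1}(p,p')$, then $R_{0,d'}M_{k,k'}=M_{k,k'+d'}$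 for all $d'\ge 0$, $k\ge p$, $k'\ge p'$. 3. If $M$ is weakly $(p,p')$-regular and $H^0_{\mathfrak m}(M)_{k,k'}=0$ for all $(k,k')\in Reg'_{-1}(p,p')\cup Reg''_{-1}(p,p')$, then $R_{d,d'}M_{k,k'}=M_{k+d,k'+d'}$ for all $d,d'\ge 0$, $k\ge p$, $k'\ge p'$. -/

import Mathlib

open CategoryTheory CategoryTheory.Limits
open scoped Pointwise

universe u v

set_option linter.unusedSectionVars false

noncomputable section

/-! ### Internal direct sum decompositions and projections -/

section Internal

variable {ι : Type} [DecidableEq ι]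

/-- Criterion: subgroups with a compatible family of projections give an internal direct sum. -/
theorem isInternal_of_proj {X : Type u} [AddCommGroup X] (P : ι → AddSubgroup X)
    (π : ι → X →+ X) (hmem : ∀ i x, π i x ∈ P i)
    (hself : ∀ i x, x ∈ P i → π i x = x) (hne : ∀ i j x, x ∈ P i → i ≠ j → π j x = 0)
    (hsum : ∀ x, ∃ s : Finset ι, ∑ i ∈ s, π i x = x) : DirectSum.IsInternal P := by
  constructor
  · rw [injective_iff_map_eq_zero]
    intro z hz
    ext j
    have key : ∀ z : DirectSum ι (fun i => P i),
        π j (DirectSum.coeAddMonoidHom P z) = (z j : X) := by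
      intro z
      induction z using DirectSum.induction_on with
      | zero => simp
      | of i x =>
        rw [DirectSum.coeAddMonoidHom_of]
        by_cases h : i = j
        · subst h
          rw [DirectSum.of_eq_same, hself _ _ x.2]
        · rw [DirectSum.of_eq_of_ne _ _ _ (Ne.symm h), hne i j _ x.2 h]
          rfl
      | add a b ha hb => rw [map_add, map_add, ha, hb]; rfl
    rw [← key z, hz, map_zero]
    rfl
  · intro x
    obtain ⟨s, hs⟩ := hsum x
    refine ⟨∑ i ∈ s, DirectSum.of (fun i => P i) i ⟨π i x, hmem i x⟩, ?_⟩
    rw [map_sum]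
    simpa [DirectSum.coeAddMonoidHom_of] using hs

variable {X : Type u} [AddCommGroup X] {P : ι → AddSubgroup X}

/-- The projection of an internal direct sum onto one of its summands. -/
def internalProj (h : DirectSum.IsInternal P) (i : ι) : X →+ X :=
  ((P i).subtype.comp (DFinsupp.evalAddMonoidHom i)).comp
    (AddEquiv.ofBijective (DirectSum.coeAddMonoidHom P) h).symm.toAddMonoidHom

theorem internalProj_apply (h : DirectSum.IsInternal P) (i : ι)
    (z : DirectSum ι (fun i => P i)) :
    internalProj h i (DirectSum.coeAddMonoidHom P z) = (z i : X) := by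
  have : (AddEquiv.ofBijective (DirectSum.coeAddMonoidHom P) h).symm
      (DirectSum.coeAddMonoidHom P z) = z :=
    (AddEquiv.ofBijective (DirectSum.coeAddMonoidHom P) h).symm_apply_apply z
  change (((AddEquiv.ofBijective (DirectSum.coeAddMonoidHom P) h).symm
      (DirectSum.coeAddMonoidHom P z)) i : X) = _
  rw [this]

theorem internalProj_mem (h : DirectSum.IsInternal P) (i : ι) (x : X) :
    internalProj h i x ∈ P i :=
  SetLike.coe_mem _

theorem internalProj_self (h : DirectSum.IsInternal P) (i : ι) (x : X) (hx : x ∈ P i) :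
    internalProj h i x = x := by
  have := internalProj_apply h i (DirectSum.of (fun i => P i) i ⟨x, hx⟩)
  rw [DirectSum.coeAddMonoidHom_of, DirectSum.of_eq_same] at this
  exact this

theorem internalProj_ne (h : DirectSum.IsInternal P) (i j : ι) (x : X) (hx : x ∈ P i)
    (hij : i ≠ j) : internalProj h j x = 0 := by
  have := internalProj_apply h j (DirectSum.of (fun i => P i) i ⟨x, hx⟩)
  rw [DirectSum.coeAddMonoidHom_of, DirectSum.of_eq_of_ne _ _ _ (Ne.symm hij)] at this
  exact this

theorem internalProj_sum (h : DirectSum.IsInternal P) (x : X) :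
    ∃ s : Finset ι, ∑ i ∈ s, internalProj h i x = x := by
  classical
  obtain ⟨z, rfl⟩ := h.2 x
  refine ⟨DFinsupp.support z, ?_⟩
  simp_rw [internalProj_apply]
  exact (DirectSum.coeAddMonoidHom_eq_dfinsuppSum P z).symm

/-- Degree-preserving additive maps commute with the projections. -/
theorem map_internalProj {Y : Type u} [AddCommGroup Y] {Q : ι → AddSubgroup Y}
    (h : DirectSum.IsInternal P) (h' : DirectSum.IsInternal Q) (f : X →+ Y)
    (hf : ∀ i x, x ∈ P i → f x ∈ Q i) (i : ι) (x : X) :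
    f (internalProj h i x) = internalProj h' i (f x) := by
  obtain ⟨z, rfl⟩ := h.2 x
  induction z using DirectSum.induction_on with
  | zero => simp
  | of j y =>
    rw [DirectSum.coeAddMonoidHom_of]
    by_cases hj : j = i
    · subst hj
      rw [internalProj_self h _ _ y.2, internalProj_self h' _ _ (hf _ _ y.2)]
    · rw [internalProj_ne h _ _ _ y.2 hj, internalProj_ne h' _ _ _ (hf _ _ y.2) hj, map_zero]
  | add a b ha hb => simp only [map_add, ha, hb]

/-- A subgroup that is stable under the projections is the internal direct sum of its
intersections with the summands. -/
theorem isInternal_comap_subtype (h : DirectSum.IsInternal P) (N : AddSubgroup X)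
    (hN : ∀ i x, x ∈ N → internalProj h i x ∈ N) :
    DirectSum.IsInternal (fun i => (P i).comap N.subtype) := by
  refine isInternal_of_proj _
    (fun i => ((internalProj h i).comp N.subtype).codRestrict N (fun x => hN i _ x.2))
    (fun i x => internalProj_mem h i _) (fun i x hx => Subtype.ext (internalProj_self h i _ hx))
    (fun i j x hx hij => Subtype.ext (internalProj_ne h i j _ hx hij)) (fun x => ?_)
  obtain ⟨s, hs⟩ := internalProj_sum h (x : X)
  refine ⟨s, Subtype.ext ?_⟩
  rw [AddSubgroup.val_finsetSum]
  exact hs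

/-- The image of an internal direct sum under a surjection whose kernel is stable under the
projections. -/
theorem isInternal_map {Y : Type u} [AddCommGroup Y] (h : DirectSum.IsInternal P) (f : X →+ Y)
    (hf : Function.Surjective f) (hN : ∀ i x, f x = 0 → f (internalProj h i x) = 0) :
    DirectSum.IsInternal (fun i => (P i).map f) := by
  have hle : ∀ i, f.ker ≤ (f.comp (internalProj h i)).ker := fun i x hx => hN i x hx
  have hsec : ∀ i x, (f.liftOfSurjective hf ⟨f.comp (internalProj h i), hle i⟩) (f x) =
      f (internalProj h i x) := fun i x =>
    f.liftOfRightInverse_comp_apply _ (Function.rightInverse_surjInv hf)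
      ⟨f.comp (internalProj h i), hle i⟩ x
  refine isInternal_of_proj _
    (fun i => f.liftOfSurjective hf ⟨f.comp (internalProj h i), hle i⟩) ?_ ?_ ?_ ?_
  · intro i y
    obtain ⟨x, rfl⟩ := hf y
    rw [hsec]
    exact ⟨_, internalProj_mem h i x, rfl⟩
  · rintro i _ ⟨x, hx, rfl⟩
    rw [hsec, internalProj_self h i x hx]
  · rintro i j _ ⟨x, hx, rfl⟩ hij
    rw [hsec, internalProj_ne h i j x hx hij, map_zero]
  · intro y
    obtain ⟨x, rfl⟩ := hf y
    obtain ⟨s, hs⟩ := internalProj_sum h x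
    refine ⟨s, ?_⟩
    simp_rw [hsec]
    rw [← map_sum, hs]

end Internal

/-! ### The abelian category of graded modules -/

section Category

variable {ι : Type} [AddCommGroup ι] [DecidableEq ι] {A : Type v} {R : Type u} [CommRing A]
  [CommRing R] [Algebra A R] (𝓡 : ι → Submodule A R) [GradedAlgebra 𝓡]

/-- Graded modules over a graded ring. -/
structure GrMod where
  /-- the underlying module -/
  carrier : Type u
  [addCommGroup : AddCommGroup carrier]
  [module : Module R carrier]
  /-- the homogeneous pieces -/
  piece : ι → AddSubgroup carrier
  isInternal : DirectSum.IsInternal piece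
  smul_mem : ∀ (a k : ι) (r : R) (m : carrier), r ∈ 𝓡 a → m ∈ piece k → r • m ∈ piece (a + k)

attribute [instance] GrMod.addCommGroup GrMod.module

namespace GrMod

variable {𝓡}

/-- Morphisms of graded modules: linear maps that preserve degrees. -/
@[ext]
structure Hom (M N : GrMod 𝓡) where
  /-- the underlying linear map -/
  lin : M.carrier →ₗ[R] N.carrier
  map_mem : ∀ (k : ι) (x : M.carrier), x ∈ M.piece k → lin x ∈ N.piece k

instance : Category (GrMod 𝓡) where
  Hom M N := Hom M N
  id M := ⟨LinearMap.id, fun _ _ h => h⟩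
  comp f g := ⟨g.lin.comp f.lin, fun k x h => g.map_mem k _ (f.map_mem k x h)⟩

variable {M N K : GrMod 𝓡}

@[ext]
theorem hom_ext {f g : M ⟶ N} (h : ∀ x, f.lin x = g.lin x) : f = g :=
  Hom.ext (LinearMap.ext h)

@[simp] theorem id_lin : Hom.lin (𝟙 M) = LinearMap.id := rfl
@[simp] theorem comp_lin (f : M ⟶ N) (g : N ⟶ K) : (f ≫ g).lin = g.lin.comp f.lin := rfl

instance : Add (M ⟶ N) :=
  ⟨fun f g => ⟨f.lin + g.lin, fun k x h => add_mem (f.map_mem k x h) (g.map_mem k x h)⟩⟩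
instance : Zero (M ⟶ N) := ⟨⟨0, fun k _ _ => zero_mem (N.piece k)⟩⟩
instance : Neg (M ⟶ N) := ⟨fun f => ⟨-f.lin, fun k x h => neg_mem (f.map_mem k x h)⟩⟩
instance : Sub (M ⟶ N) :=
  ⟨fun f g => ⟨f.lin - g.lin, fun k x h => sub_mem (f.map_mem k x h) (g.map_mem k x h)⟩⟩
instance : SMul ℕ (M ⟶ N) :=
  ⟨fun n f => ⟨n • f.lin, fun k x h => nsmul_mem (f.map_mem k x h) n⟩⟩
instance : SMul ℤ (M ⟶ N) :=
  ⟨fun n f => ⟨n • f.lin, fun k x h => zsmul_mem (f.map_mem k x h) n⟩⟩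

theorem lin_injective : Function.Injective (fun f : M ⟶ N => f.lin) :=
  fun _ _ h => Hom.ext h

instance : AddCommGroup (M ⟶ N) :=
  lin_injective.addCommGroup _ rfl (fun _ _ => rfl) (fun _ => rfl) (fun _ _ => rfl)
    (fun _ _ => rfl) (fun _ _ => rfl)

@[simp] theorem add_lin (f g : M ⟶ N) : (f + g).lin = f.lin + g.lin := rfl
@[simp] theorem zero_lin : (0 : M ⟶ N).lin = 0 := rfl

instance : Preadditive (GrMod 𝓡) where
  add_comp _ _ _ f f' g := by ext x; exact map_add g.lin _ _
  comp_add _ _ _ f g g' := by ext x; rfl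

/-- The projection of a graded module onto its piece of degree `k`. -/
def proj (M : GrMod 𝓡) (k : ι) : M.carrier →+ M.carrier := internalProj M.isInternal k

theorem lin_proj (f : M ⟶ N) (k : ι) (x : M.carrier) :
    f.lin (M.proj k x) = N.proj k (f.lin x) :=
  map_internalProj M.isInternal N.isInternal f.lin.toAddMonoidHom f.map_mem k x

theorem mem_piece_iff (M : GrMod 𝓡) (k : ι) (x : M.carrier) : x ∈ M.piece k ↔ M.proj k x = x :=
  ⟨internalProj_self _ k x, fun h => h ▸ internalProj_mem M.isInternal k x⟩

/-- The graded submodule on a submodule that is stable under the projections. -/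
abbrev sub (M : GrMod 𝓡) (L : Submodule R M.carrier) (hL : ∀ k x, x ∈ L → M.proj k x ∈ L) :
    GrMod 𝓡 where
  carrier := L
  piece k := (M.piece k).comap L.toAddSubgroup.subtype
  isInternal := isInternal_comap_subtype M.isInternal L.toAddSubgroup hL
  smul_mem a k r m hr hm := M.smul_mem a k r m hr hm

/-- The quotient of a graded module by a submodule that is stable under the projections. -/
abbrev quot (M : GrMod 𝓡) (L : Submodule R M.carrier) (hL : ∀ k x, x ∈ L → M.proj k x ∈ L) :
    GrMod 𝓡 where
  carrier := M.carrier ⧸ L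
  piece k := (M.piece k).map L.mkQ.toAddMonoidHom
  isInternal := isInternal_map M.isInternal L.mkQ.toAddMonoidHom L.mkQ_surjective
    (fun k x hx => (Submodule.Quotient.mk_eq_zero L).2
      (hL k x ((Submodule.Quotient.mk_eq_zero L).1 hx)))
  smul_mem := by
    rintro a k r _ hr ⟨m, hm, rfl⟩
    exact ⟨r • m, M.smul_mem a k r m hr hm, rfl⟩

theorem ker_stable (f : M ⟶ N) (k : ι) (x : M.carrier) (hx : x ∈ LinearMap.ker f.lin) :
    M.proj k x ∈ LinearMap.ker f.lin := by
  rw [LinearMap.mem_ker] at hx ⊢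
  rw [lin_proj, hx, map_zero]

theorem range_stable (f : M ⟶ N) (k : ι) (x : N.carrier) (hx : x ∈ LinearMap.range f.lin) :
    N.proj k x ∈ LinearMap.range f.lin := by
  obtain ⟨y, rfl⟩ := hx
  exact ⟨M.proj k y, lin_proj f k y⟩

/-- The inclusion of the kernel. -/
def kerι (f : M ⟶ N) : M.sub (LinearMap.ker f.lin) (ker_stable f) ⟶ M where
  lin := (LinearMap.ker f.lin).subtype
  map_mem _ _ h := h

/-- The projection onto the cokernel. -/
def cokerπ (f : M ⟶ N) : N ⟶ N.quot (LinearMap.range f.lin) (range_stable f) where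
  lin := (LinearMap.range f.lin).mkQ
  map_mem _ x h := ⟨x, h, rfl⟩

theorem kerι_comp (f : M ⟶ N) : kerι f ≫ f = 0 := by
  ext x
  exact x.2

theorem comp_cokerπ (f : M ⟶ N) : f ≫ cokerπ f = 0 := by
  ext x
  exact (Submodule.Quotient.mk_eq_zero _).2 ⟨x, rfl⟩

/-- A morphism killed by an injective morphism's cokernel factors through it. -/
theorem exists_lift (f : M ⟶ N) (hf : Function.Injective f.lin) (g : K ⟶ N)
    (hg : ∀ x, g.lin x ∈ LinearMap.range f.lin) : ∃ l : K ⟶ M, l ≫ f = g := by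
  let e := LinearEquiv.ofInjective f.lin hf
  have he : ∀ x, f.lin (e.symm ⟨g.lin x, hg x⟩) = g.lin x := fun x =>
    congrArg Subtype.val (e.apply_symm_apply ⟨g.lin x, hg x⟩)
  refine ⟨⟨e.symm.toLinearMap.comp (g.lin.codRestrict _ hg), fun k x hx => ?_⟩, ?_⟩
  · rw [mem_piece_iff]
    apply hf
    rw [lin_proj]
    change N.proj k (f.lin (e.symm ⟨g.lin x, hg x⟩)) = f.lin (e.symm ⟨g.lin x, hg x⟩)
    rw [he]
    exact (mem_piece_iff _ _ _).1 (g.map_mem k x hx)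
  · ext x
    exact he x

/-- A morphism killed by the kernel of a surjective morphism factors through it. -/
theorem exists_desc (f : M ⟶ N) (hf : Function.Surjective f.lin) (g : M ⟶ K)
    (hg : ∀ x, f.lin x = 0 → g.lin x = 0) : ∃ l : N ⟶ K, f ≫ l = g := by
  let e := f.lin.quotKerEquivOfSurjective hf
  let l : N.carrier →ₗ[R] K.carrier :=
    ((LinearMap.ker f.lin).liftQ g.lin hg).comp e.symm.toLinearMap
  have hl : ∀ x, l (f.lin x) = g.lin x := fun x => by
    have : e.symm (f.lin x) = (LinearMap.ker f.lin).mkQ x := by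
      rw [LinearEquiv.symm_apply_eq]; rfl
    change (LinearMap.ker f.lin).liftQ g.lin hg (e.symm (f.lin x)) = _
    rw [this]; rfl
  refine ⟨⟨l, fun k y hy => ?_⟩, by ext x; exact hl x⟩
  obtain ⟨x, rfl⟩ := hf y
  rw [mem_piece_iff] at hy
  rw [← hy, ← lin_proj, hl]
  exact g.map_mem k _ (internalProj_mem M.isInternal k x)

theorem mono_of_injective (f : M ⟶ N) (hf : Function.Injective f.lin) : Mono f :=
  ⟨fun g h e => by
    ext x
    exact hf (congrArg (fun t : _ ⟶ N => t.lin x) e)⟩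

theorem epi_of_surjective (f : M ⟶ N) (hf : Function.Surjective f.lin) : Epi f :=
  ⟨fun g h e => by
    ext y
    obtain ⟨x, rfl⟩ := hf y
    exact congrArg (fun t : M ⟶ _ => t.lin x) e⟩

theorem injective_of_mono (f : M ⟶ N) [Mono f] : Function.Injective f.lin := by
  have h : kerι f = 0 := by
    rw [← cancel_mono f, kerι_comp, zero_comp]
  rw [injective_iff_map_eq_zero]
  intro x hx
  exact congrArg (fun t : M.sub (LinearMap.ker f.lin) (ker_stable f) ⟶ M => t.lin ⟨x, hx⟩) h

theorem surjective_of_epi (f : M ⟶ N) [Epi f] : Function.Surjective f.lin := by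
  have h : cokerπ f = 0 := by
    rw [← cancel_epi f, comp_cokerπ, comp_zero]
  intro y
  exact (Submodule.Quotient.mk_eq_zero _).1 (congrArg (fun t : N ⟶ _ => t.lin y) h)

/-- An injective morphism is the kernel of any morphism whose kernel is its range. -/
def isLimitKernelFork (f : M ⟶ N) (g : N ⟶ K) (w : f ≫ g = 0) (hf : Function.Injective f.lin)
    (hfg : ∀ y, g.lin y = 0 → y ∈ LinearMap.range f.lin) : IsLimit (KernelFork.ofι f w) :=
  have : Mono f := mono_of_injective f hf
  have H : ∀ {W : GrMod 𝓡} (k : W ⟶ N), k ≫ g = 0 → ∃ l : W ⟶ M, l ≫ f = k := fun k hk =>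
    exists_lift f hf k (fun x => hfg _ (congrArg (fun t : _ ⟶ K => t.lin x) hk))
  KernelFork.IsLimit.ofι' f w (fun k hk => ⟨(H k hk).choose, (H k hk).choose_spec⟩)

/-- A surjective morphism is the cokernel of any morphism whose range is its kernel. -/
def isColimitCokernelCofork (g : K ⟶ M) (f : M ⟶ N) (w : g ≫ f = 0)
    (hf : Function.Surjective f.lin)
    (hfg : ∀ x, f.lin x = 0 → x ∈ LinearMap.range g.lin) : IsColimit (CokernelCofork.ofπ f w) :=
  have : Epi f := epi_of_surjective f hf
  have H : ∀ {W : GrMod 𝓡} (k : M ⟶ W), g ≫ k = 0 → ∃ l : N ⟶ W, f ≫ l = k := fun k hk =>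
    exists_desc f hf k (fun x hx => by
      obtain ⟨z, rfl⟩ := hfg x hx
      exact congrArg (fun t : K ⟶ _ => t.lin z) hk)
  CokernelCofork.IsColimit.ofπ' f w (fun k hk => ⟨(H k hk).choose, (H k hk).choose_spec⟩)

instance : HasKernels (GrMod 𝓡) where
  has_limit f := ⟨⟨⟨_, isLimitKernelFork (kerι f) f (kerι_comp f) Subtype.val_injective
    (fun y hy => ⟨⟨y, hy⟩, rfl⟩)⟩⟩⟩

instance : HasCokernels (GrMod 𝓡) where
  has_colimit f := ⟨⟨⟨_, isColimitCokernelCofork f (cokerπ f) (comp_cokerπ f)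
    (Submodule.mkQ_surjective _) (fun _ hx => (Submodule.Quotient.mk_eq_zero _).1 hx)⟩⟩⟩

instance : IsNormalMonoCategory (GrMod 𝓡) where
  normalMonoOfMono f _ := ⟨⟨_, cokerπ f, comp_cokerπ f,
    isLimitKernelFork f (cokerπ f) (comp_cokerπ f) (injective_of_mono f)
      (fun _ hy => (Submodule.Quotient.mk_eq_zero _).1 hy)⟩⟩

instance : IsNormalEpiCategory (GrMod 𝓡) where
  normalEpiOfEpi f _ := ⟨⟨_, kerι f, kerι_comp f,
    isColimitCokernelCofork (kerι f) f (kerι_comp f) (surjective_of_epi f)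
      (fun x hx => ⟨⟨x, hx⟩, rfl⟩)⟩⟩

/-- The zero graded module. -/
def zeroObj (𝓡 : ι → Submodule A R) [GradedAlgebra 𝓡] : GrMod 𝓡 where
  carrier := PUnit
  piece _ := ⊥
  isInternal := isInternal_of_proj _ (fun _ => 0) (fun _ _ => rfl) (fun _ _ _ => rfl)
    (fun _ _ _ _ _ => rfl) (fun _ => ⟨∅, rfl⟩)
  smul_mem _ _ _ _ _ _ := rfl

instance : HasZeroObject (GrMod 𝓡) :=
  ⟨⟨zeroObj 𝓡, (IsZero.iff_id_eq_zero _).2 (hom_ext (fun _ => rfl))⟩⟩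

/-- The direct sum of two graded modules. -/
abbrev prod (M N : GrMod 𝓡) : GrMod 𝓡 where
  carrier := M.carrier × N.carrier
  piece k := (M.piece k).prod (N.piece k)
  isInternal := by
    refine isInternal_of_proj _ (fun k => (M.proj k).prodMap (N.proj k))
      (fun k x => ⟨internalProj_mem _ k _, internalProj_mem _ k _⟩)
      (fun k x hx => Prod.ext (internalProj_self _ k _ hx.1) (internalProj_self _ k _ hx.2))
      (fun k l x hx h => Prod.ext (internalProj_ne _ k l _ hx.1 h)
        (internalProj_ne _ k l _ hx.2 h)) (fun x => ?_)
    have aux : ∀ (L : GrMod 𝓡) (y : L.carrier), ∃ s : Finset ι, ∀ t : Finset ι, s ⊆ t →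
        ∑ k ∈ t, L.proj k y = y := by
      intro L y
      obtain ⟨s, hs⟩ := internalProj_sum L.isInternal y
      refine ⟨s, fun t hst => ?_⟩
      rw [← Finset.sum_subset hst (fun k _ hk => ?_)]
      · exact hs
      · rw [← hs]
        rw [proj, map_sum]
        refine Finset.sum_eq_zero (fun l hl => ?_)
        exact internalProj_ne _ l k _ (internalProj_mem _ l y) (fun h => hk (h ▸ hl))
    obtain ⟨s, hs⟩ := aux M x.1
    obtain ⟨t, ht⟩ := aux N x.2
    refine ⟨s ∪ t, Prod.ext ?_ ?_⟩
    · rw [Prod.fst_sum]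
      exact hs _ Finset.subset_union_left
    · rw [Prod.snd_sum]
      exact ht _ Finset.subset_union_right
  smul_mem a k r m hr hm := ⟨M.smul_mem a k r _ hr hm.1, N.smul_mem a k r _ hr hm.2⟩

instance : HasBinaryBiproducts (GrMod 𝓡) :=
  HasBinaryBiproducts.mk (fun {M N} => hasBinaryBiproduct_of_total
    { pt := M.prod N
      fst := ⟨LinearMap.fst R _ _, fun _ _ h => h.1⟩
      snd := ⟨LinearMap.snd R _ _, fun _ _ h => h.2⟩
      inl := ⟨LinearMap.inl R _ _, fun k _ h => ⟨h, zero_mem (N.piece k)⟩⟩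
      inr := ⟨LinearMap.inr R _ _, fun k _ h => ⟨zero_mem (M.piece k), h⟩⟩
      inl_fst := rfl
      inl_snd := rfl
      inr_fst := rfl
      inr_snd := rfl }
    (by
      refine hom_ext (fun (x : M.carrier × N.carrier) => ?_)
      change ((x.1, 0) + (0, x.2) : M.carrier × N.carrier) = x
      simp))

instance : Abelian (GrMod 𝓡) where
  has_finite_products :=
    have : HasTerminal (GrMod 𝓡) := HasZeroObject.hasTerminal
    hasFiniteProducts_of_has_binary_and_terminal
  has_kernels := inferInstance
  has_cokernels := inferInstance

instance : HasExt.{u + 1} (GrMod 𝓡) := HasExt.standard _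

/-- The shift `M(k)` of a graded module: `M(k)_a = M_{a + k}`. -/
abbrev shift (M : GrMod 𝓡) (k : ι) : GrMod 𝓡 where
  carrier := M.carrier
  piece a := M.piece (a + k)
  isInternal := by
    refine isInternal_of_proj _ (fun a => M.proj (a + k)) (fun a x => internalProj_mem _ _ x)
      (fun a x hx => internalProj_self _ _ x hx)
      (fun a b x hx h => internalProj_ne _ _ _ x hx (fun e => h (add_right_cancel e)))
      (fun x => ?_)
    obtain ⟨s, hs⟩ := internalProj_sum M.isInternal x
    refine ⟨s.map (Equiv.subRight k).toEmbedding, ?_⟩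
    rw [Finset.sum_map]
    simpa [proj] using hs
  smul_mem a b r m hr hm := by
    have := M.smul_mem a (b + k) r m hr hm
    rwa [← add_assoc] at this

/-- The graded ring as a graded module over itself. -/
abbrev self (𝓡 : ι → Submodule A R) [GradedAlgebra 𝓡] : GrMod 𝓡 where
  carrier := R
  piece k := (𝓡 k).toAddSubgroup
  isInternal := DirectSum.Decomposition.isInternal 𝓡
  smul_mem _ _ _ _ hr hm := SetLike.mul_mem_graded hr hm

theorem self_proj (k : ι) (x : R) : (self 𝓡).proj k x = GradedRing.proj 𝓡 k x := by
  obtain ⟨z, rfl⟩ := (self 𝓡).isInternal.2 x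
  refine (internalProj_apply (self 𝓡).isInternal k z).trans ?_
  have : DirectSum.coeAddMonoidHom (self 𝓡).piece z = (DirectSum.decompose 𝓡).symm z := rfl
  rw [this, GradedRing.proj_apply, Equiv.apply_symm_apply]

end GrMod

/-- Homogeneous ideals are stable under the projections. -/
theorem stable_of_isHomogeneous (I : Ideal R) (hI : I.IsHomogeneous 𝓡) (k : ι)
    (x : (GrMod.self 𝓡).carrier) (hx : x ∈ I) : (GrMod.self 𝓡).proj k x ∈ I := by
  rw [GrMod.self_proj]
  exact hI k hx

theorem isHomogeneous_pow (I : Ideal R) (hI : I.IsHomogeneous 𝓡) (n : ℕ) :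
    (I ^ n).IsHomogeneous 𝓡 := by
  induction n with
  | zero => rw [pow_zero, Ideal.one_eq_top]; exact Ideal.IsHomogeneous.top 𝓡
  | succ n ih => rw [pow_succ]; exact ih.mul hI

/-- The inverse system `R / I ^ n` of graded modules. -/
def quotPow (I : Ideal R) (hI : I.IsHomogeneous 𝓡) : ℕᵒᵖ ⥤ GrMod 𝓡 where
  obj n := (GrMod.self 𝓡).quot (I ^ n.unop)
    (stable_of_isHomogeneous 𝓡 _ (isHomogeneous_pow 𝓡 I hI n.unop))
  map {n m} f := ⟨Submodule.factor (Ideal.pow_le_pow_right (leOfHom f.unop)), by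
    rintro k _ ⟨x, hx, rfl⟩
    exact ⟨x, hx, rfl⟩⟩
  map_id n := by
    ext x
    obtain ⟨x, rfl⟩ := Submodule.Quotient.mk_surjective _ x
    rfl
  map_comp f g := by
    ext x
    obtain ⟨x, rfl⟩ := Submodule.Quotient.mk_surjective _ x
    rfl

/-- The piece `H^i_I(M)_k` of degree `k` of the `i`-th local cohomology of a graded module `M`
with support in a homogeneous ideal `I`: the direct limit over `n` of the groups
`Ext^i(R / I ^ n, M)_k = Ext^i(R / I ^ n, M(k))`, where the last `Ext` is taken in the category of
graded modules. -/
def gradedLocalCohomology (I : Ideal R) (hI : I.IsHomogeneous 𝓡) (i : ℕ) (M : GrMod 𝓡) (k : ι) :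
    AddCommGrpCat.{u + 1} :=
  colimit ((quotPow 𝓡 I hI).rightOp ⋙ (Abelian.extFunctor i).flip.obj (M.shift k))

end Category

/-! ### Bihomogeneous algebras -/

section Bigraded

variable {A : Type v} {R : Type u} [CommRing A] [CommRing R] [Algebra A R]
  (𝓡 : ℤ × ℤ → Submodule A R)

/-- Bihomogeneous `A`-algebras: bigraded in nonnegative degrees, with `R_{0,0} = A`, and finitely
generated by homogeneous elements of bidegrees `(1,0)` and `(0,1)`. -/
structure IsBihomogeneousAlgebra [GradedAlgebra 𝓡] : Prop where
  eq_bot : ∀ a b : ℤ, ¬(0 ≤ a ∧ 0 ≤ b) → 𝓡 (a, b) = ⊥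
  algebraMap_injective : Function.Injective (algebraMap A R)
  piece_zero : ∀ r : R, r ∈ 𝓡 (0, 0) ↔ r ∈ Set.range (algebraMap A R)
  exists_generators : ∃ s : Finset R, (∀ r ∈ s, r ∈ 𝓡 (1, 0) ∨ r ∈ 𝓡 (0, 1)) ∧
    Algebra.adjoin A (s : Set R) = ⊤

/-- The irrelevant ideal, generated by the `R_{a,b}` with `a > 0` and `b > 0` (for a bigrading in
nonnegative degrees it is the direct sum of these pieces). -/
def irrelevantIdeal : Ideal R :=
  Ideal.span {r | ∃ a b : ℤ, 0 < a ∧ 0 < b ∧ r ∈ 𝓡 (a, b)}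

theorem irrelevantIdeal_isHomogeneous [GradedAlgebra 𝓡] :
    (irrelevantIdeal 𝓡).IsHomogeneous 𝓡 :=
  Ideal.homogeneous_span 𝓡 _ (fun _ ⟨a, b, _, _, h⟩ => ⟨(a, b), h⟩)

/-- The bigraded module with given pieces, as an object of the category of bigraded modules. -/
abbrev bigradedModule [GradedAlgebra 𝓡] {M : Type u} [AddCommGroup M] [Module R M]
    (𝓜 : ℤ × ℤ → AddSubgroup M) [DirectSum.Decomposition 𝓜] [SetLike.GradedSMul 𝓡 𝓜] :
    GrMod 𝓡 where
  carrier := M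
  piece := 𝓜
  isInternal := DirectSum.Decomposition.isInternal 𝓜
  smul_mem _ _ _ _ hr hm := SetLike.GradedSMul.smul_mem hr hm

/-- The group `H^i_𝔪(M)_{k,k'}`, for the irrelevant ideal `𝔪`. -/
def bigradedLocalCohomology [GradedAlgebra 𝓡] {M : Type u} [AddCommGroup M] [Module R M]
    (𝓜 : ℤ × ℤ → AddSubgroup M) [DirectSum.Decomposition 𝓜] [SetLike.GradedSMul 𝓡 𝓜]
    (i : ℕ) (k : ℤ × ℤ) : AddCommGrpCat.{u + 1} :=
  gradedLocalCohomology 𝓡 (irrelevantIdeal 𝓡) (irrelevantIdeal_isHomogeneous 𝓡) i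
    (bigradedModule 𝓡 𝓜) k

/-- The staircases `St_i`. -/
def staircase (i : ℤ) : Set (ℤ × ℤ) :=
  if 0 < i then {q | q.1 + q.2 = -i - 1 ∧ q.1 < 0 ∧ q.2 < 0}
  else {q | q.1 + q.2 = -i ∧ 0 ≤ q.1 ∧ 0 ≤ q.2}

/-- The translated staircases `St_i(p,p') = (p,p') + St_i`. -/
def staircaseAt (i : ℤ) (p : ℤ × ℤ) : Set (ℤ × ℤ) := p +ᵥ staircase i

/-- The regions `Reg_i(p,p')`, `i ≥ -1`: for `i ≥ 0` this is `ℤ₊² + St_i(p,p')`, and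
`Reg_{-1}(p,p') = ℤ₊² + (p+1,p'+1)`. -/
def regRegion (i : ℤ) (p : ℤ × ℤ) : Set (ℤ × ℤ) :=
  if 0 ≤ i then Set.Ici (0 : ℤ × ℤ) + staircaseAt i p
  else Set.Ici (0 : ℤ × ℤ) + {(p.1 + 1, p.2 + 1)}

/-- The region `Reg'_{-1}(p,p') = (p+1,p') + ℤ₊²`. -/
def regRegion' (p : ℤ × ℤ) : Set (ℤ × ℤ) := {(p.1 + 1, p.2)} + Set.Ici (0 : ℤ × ℤ)

/-- The region `Reg''_{-1}(p,p') = (p,p'+1) + ℤ₊²`. -/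
def regRegion'' (p : ℤ × ℤ) : Set (ℤ × ℤ) := {(p.1, p.2 + 1)} + Set.Ici (0 : ℤ × ℤ)

/-- Weakly `(p,p')`-regular bigraded modules. -/
def IsWeaklyRegular [GradedAlgebra 𝓡] {M : Type u} [AddCommGroup M] [Module R M]
    (𝓜 : ℤ × ℤ → AddSubgroup M) [DirectSum.Decomposition 𝓜] [SetLike.GradedSMul 𝓡 𝓜]
    (p : ℤ × ℤ) : Prop :=
  ∀ i : ℕ, ∀ k ∈ regRegion ((i : ℤ) - 1) p, Subsingleton (bigradedLocalCohomology 𝓡 𝓜 i k)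

/-- The subgroup `R_a M_k` generated by the products of elements of `R_a` and of `M_k`. -/
def pieceMul {M : Type u} [AddCommGroup M] [Module R M] (𝓜 : ℤ × ℤ → AddSubgroup M)
    (a k : ℤ × ℤ) : AddSubgroup M :=
  AddSubgroup.closure {z | ∃ r ∈ 𝓡 a, ∃ m ∈ 𝓜 k, r • m = z}

end Bigraded

end

/-!
The proof replaces generic hyperplane sections by the Koszul complex on the generators of `R` of
bidegree `(1,0)` (or `(0,1)`), and so needs no base change and no induction on dimension.

Let `x₁, …, xₙ` be the generators of degree `a = (1,0)`. The ideal they generate contains the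
irrelevant ideal `𝔪` (`mem_span_of_generators`). Let `K` be their Koszul complex on `M`; its `j`-th
term is a sum of copies of `M(-j a)`. Each `xᵢ` is null homotopic on `K`, so the homology of `K`,
and in particular `M / ∑ xᵢ M`, is killed by `𝔪`. Modules killed by `𝔪` have no local cohomology in
positive degrees (`LocalCohomologyVanishes.of_smul_eq_zero`), so `K` behaves like an exact complex
for `H^i_𝔪`, `i > 0`. Splitting it into short exact sequences of cycles and boundaries gives:

* if `H^{i+j}_𝔪(M)_{k - j a} = 0` for all `j ≥ 0`, where `i ≥ 1`, then `H^i_𝔪(M)_{k + a} = 0`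
  (`localCohomologyVanishes_add`);
* if moreover `i = 1` and `H^0_𝔪(M)_{k + a} = 0`, then `M / ∑ xᵢ M`, which is its own `H^0_𝔪`, is zero
  in degree `k + a`, that is, `M_{k + a} = ∑ xᵢ M_k` (`mem_closure_of_vanishes`).

The staircases are made for the first statement: if `(r,s)` lies on the staircase that belongs to
`i ≥ 2`, then `(r,s) - j a` lies on the one that belongs to `i + j`. So the vanishing spreads
from the staircases to the regions above them, first in one direction and then in the other, and
afterwards to `i = 1` (`regRegion_of_staircaseAt`). Iterating the second statement gives the
equalities `R_{d,0} M_{k,k'} = M_{d+k,k'}`.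

That local cohomology, defined as a direct limit of `Ext` groups of graded modules, vanishes in
positive degrees on modules killed by `𝔪` is where the noetherian hypothesis enters:
an extension class of a finitely generated `X` by such a module dies on `𝔪ⁿ X` for some `n`, by
dimension shifting and the Artin–Rees lemma (`exists_ext_restrict_eq_zero`).
-/

noncomputable section

/-! ### Vanishing of direct limits of Ext groups -/

section IndExt

universe w' v' u'

variable {C : Type u'} [Category.{v'} C] [Abelian C] [HasExt.{w'} C]

/-- Naturality of the connecting map: if `e` dies along the left component of a morphism of short
exact sequences, then its image under the connecting map dies along the right component. -/
theorem mk₀_comp_extClass_comp_eq_zero {S₁ S₂ : ShortComplex C} (h₁ : S₁.ShortExact)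
    (h₂ : S₂.ShortExact) (φ : S₁ ⟶ S₂) {T : C} {i i' : ℕ} (e : Abelian.Ext S₂.X₁ T i)
    (hi : 1 + i = i') (he : (Abelian.Ext.mk₀ φ.τ₁).comp e (zero_add i) = 0) :
    (Abelian.Ext.mk₀ φ.τ₃).comp (h₂.extClass.comp e hi) (zero_add i') = 0 := by
  rw [← Abelian.Ext.comp_assoc (a₁₂ := 1) _ _ _ (by lia) (by lia) (by lia),
    ← ShortComplex.ShortExact.extClass_naturality h₁ h₂ φ,
    Abelian.Ext.comp_assoc (a₂₃ := i) _ _ _ (by lia) (by lia) (by lia), he,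
    Abelian.Ext.comp_zero]

/-- The direct limit over `n` of the groups `Ext^i(X n, N)` vanishes, expressed elementwise:
each class dies after pulling it back along some transition map of the inverse system `X`. -/
def IndExtVanishes (X : ℕᵒᵖ ⥤ C) (i : ℕ) (N : C) : Prop :=
  ∀ (n : ℕ) (e : Abelian.Ext (X.obj (.op n)) N i), ∃ (m : ℕ) (h : n ≤ m),
    (Abelian.Ext.mk₀ (X.map (homOfLE h).op)).comp e (zero_add i) = 0

theorem subsingleton_colimit_iff_indExtVanishes (X : ℕᵒᵖ ⥤ C) (i : ℕ) (N : C) :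
    Subsingleton (colimit (X.rightOp ⋙ (Abelian.extFunctor i).flip.obj N) : AddCommGrpCat.{w'}) ↔
      IndExtVanishes X i N := by
  set F := X.rightOp ⋙ (Abelian.extFunctor i).flip.obj N
  have : PreservesColimit F (forget AddCommGrpCat.{w'}) := by
    have : PreservesFilteredColimitsOfSize.{0, 0} (forget AddCommGrpCat.{w'}) :=
      preservesFilteredColimitsOfSize_shrink _
    infer_instance
  constructor
  · intro hs n e
    obtain ⟨m, f, g, hm⟩ := Concrete.colimit_exists_of_rep_eq F
      (i := n) (j := n) e (0 : F.obj n) (Subsingleton.elim _ _)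
    refine ⟨m, leOfHom f, Eq.trans hm (map_zero _)⟩
  · intro h
    refine subsingleton_of_forall_eq 0 fun y => ?_
    obtain ⟨n, e, rfl⟩ := Concrete.colimit_exists_rep F y
    obtain ⟨m, hm, he⟩ := h n e
    have h1 := colimit.w_apply F (homOfLE hm) e
    have h2 : F.map (homOfLE hm) e = 0 := he
    rw [h2, map_zero] at h1
    exact h1.symm

namespace IndExtVanishes

variable {X : ℕᵒᵖ ⥤ C} {i : ℕ}

open Abelian (Ext)

theorem map_comp_map {n m l : ℕ} (h : n ≤ m) (h' : m ≤ l) {N : C}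
    (e : Ext (X.obj (.op n)) N i) :
    (Ext.mk₀ (X.map (homOfLE h').op)).comp
      ((Ext.mk₀ (X.map (homOfLE h).op)).comp e (zero_add i)) (zero_add i) =
    (Ext.mk₀ (X.map (homOfLE (h.trans h')).op)).comp e (zero_add i) := by
  rw [Ext.mk₀_comp_mk₀_assoc, ← X.map_comp]
  rfl

/-- Transport along a retraction. -/
theorem of_retract {N N' : C} (hN : IndExtVanishes X i N) (s : N' ⟶ N) (r : N ⟶ N')
    (h : s ≫ r = 𝟙 N') : IndExtVanishes X i N' := by
  intro n e
  obtain ⟨m, hm, he⟩ := hN n (e.comp (Ext.mk₀ s) (add_zero i))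
  refine ⟨m, hm, ?_⟩
  have := congrArg (fun t => t.comp (Ext.mk₀ r) (add_zero i)) he
  simpa [Ext.comp_assoc_of_third_deg_zero, h] using this

theorem of_isZero {N : C} (hN : IsZero N) : IndExtVanishes X i N := by
  intro n e
  refine ⟨n, le_rfl, ?_⟩
  rw [← Ext.comp_mk₀_id e, (IsZero.iff_id_eq_zero N).1 hN]
  simp

variable {S : ShortComplex C}

theorem middle (hS : S.ShortExact) (h₁ : IndExtVanishes X i S.X₁)
    (h₃ : IndExtVanishes X i S.X₃) : IndExtVanishes X i S.X₂ := by
  intro n e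
  obtain ⟨m, hm, he⟩ := h₃ n (e.comp (Ext.mk₀ S.g) (add_zero i))
  rw [← Ext.comp_assoc_of_third_deg_zero] at he
  obtain ⟨e', he'⟩ := Ext.covariant_sequence_exact₂ _ hS _ he
  obtain ⟨l, hl, hz⟩ := h₁ m e'
  refine ⟨l, hm.trans hl, ?_⟩
  rw [← map_comp_map hm hl, ← he', ← Ext.comp_assoc_of_third_deg_zero, hz, Ext.zero_comp]

theorem right (hS : S.ShortExact) (h₂ : IndExtVanishes X i S.X₂)
    (h₁ : IndExtVanishes X (i + 1) S.X₁) : IndExtVanishes X i S.X₃ := by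
  intro n e
  obtain ⟨m, hm, he⟩ := h₁ n (e.comp hS.extClass rfl)
  rw [← Ext.comp_assoc (a₁₂ := i) _ _ _ (by lia) (by lia) (by lia)] at he
  obtain ⟨e', he'⟩ := Ext.covariant_sequence_exact₃ _ hS _ rfl he
  obtain ⟨l, hl, hz⟩ := h₂ m e'
  refine ⟨l, hm.trans hl, ?_⟩
  rw [← map_comp_map hm hl, ← he', ← Ext.comp_assoc_of_third_deg_zero, hz, Ext.zero_comp]

end IndExtVanishes

end IndExt

namespace GrMod

variable {ι : Type} [AddCommGroup ι] [DecidableEq ι] {A : Type v} {R : Type u} [CommRing A]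
  [CommRing R] [Algebra A R] {𝓡 : ι → Submodule A R} [GradedAlgebra 𝓡] {M N K : GrMod 𝓡}

theorem shortExact_mk (f : M ⟶ N) (g : N ⟶ K) (w : f ≫ g = 0) (hf : Function.Injective f.lin)
    (hg : Function.Surjective g.lin) (hfg : ∀ y, g.lin y = 0 → y ∈ LinearMap.range f.lin) :
    (ShortComplex.mk f g w).ShortExact :=
  have : Mono f := mono_of_injective f hf
  have : Epi g := epi_of_surjective g hg
  { exact := ShortComplex.exact_of_f_is_kernel _ (isLimitKernelFork f g w hf hfg) }

/-- Shifting a morphism of graded modules. -/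
def Hom.shift (f : M ⟶ N) (k : ι) : M.shift k ⟶ N.shift k :=
  ⟨f.lin, fun a x hx => f.map_mem (a + k) x hx⟩

theorem isZero_of_subsingleton (h : Subsingleton M.carrier) : IsZero M :=
  (IsZero.iff_id_eq_zero _).2 (hom_ext (fun _ => Subsingleton.elim _ _))

end GrMod

section LocalCohomology

variable {ι : Type} [AddCommGroup ι] [DecidableEq ι] {A : Type v} {R : Type u} [CommRing A]
  [CommRing R] [Algebra A R] {𝓡 : ι → Submodule A R} [GradedAlgebra 𝓡]
  (I : Ideal R) (hI : I.IsHomogeneous 𝓡)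

/-- The piece of degree `k` of the `i`-th local cohomology of `N` vanishes. -/
abbrev LocalCohomologyVanishes (i : ℕ) (N : GrMod 𝓡) (k : ι) : Prop :=
  Subsingleton (gradedLocalCohomology 𝓡 I hI i N k)

namespace LocalCohomologyVanishes

variable {I hI} {i : ℕ} {k : ι} {M N K : GrMod 𝓡}

theorem iff_indExtVanishes : LocalCohomologyVanishes I hI i N k ↔
    IndExtVanishes (quotPow 𝓡 I hI) i (N.shift k) :=
  subsingleton_colimit_iff_indExtVanishes _ _ _

theorem of_subsingleton (h : Subsingleton N.carrier) : LocalCohomologyVanishes I hI i N k :=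
  iff_indExtVanishes.2 (.of_isZero (GrMod.isZero_of_subsingleton h))

theorem shift_iff {a : ι} : LocalCohomologyVanishes I hI i (N.shift a) k ↔
    LocalCohomologyVanishes I hI i N (k + a) := by
  let f : (N.shift a).shift k ⟶ N.shift (k + a) :=
    ⟨LinearMap.id, fun b x hx => by
      change x ∈ N.piece (b + (k + a))
      rw [← add_assoc]
      exact hx⟩
  let g : N.shift (k + a) ⟶ (N.shift a).shift k :=
    ⟨LinearMap.id, fun b x hx => by
      change x ∈ N.piece (b + k + a)
      rw [add_assoc]
      exact hx⟩
  rw [iff_indExtVanishes, iff_indExtVanishes]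
  exact ⟨fun h => h.of_retract g f rfl, fun h => h.of_retract f g rfl⟩

theorem middle (f : M ⟶ N) (g : N ⟶ K) (w : f ≫ g = 0) (hf : Function.Injective f.lin)
    (hg : Function.Surjective g.lin) (hfg : ∀ y, g.lin y = 0 → y ∈ LinearMap.range f.lin)
    (h₁ : LocalCohomologyVanishes I hI i M k) (h₃ : LocalCohomologyVanishes I hI i K k) :
    LocalCohomologyVanishes I hI i N k :=
  iff_indExtVanishes.2 (.middle (GrMod.shortExact_mk (GrMod.Hom.shift f k) (GrMod.Hom.shift g k)
    (GrMod.hom_ext fun x => congrArg (fun t : M ⟶ K => t.lin x) w) hf hg hfg)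
    (iff_indExtVanishes.1 h₁) (iff_indExtVanishes.1 h₃))

theorem right (f : M ⟶ N) (g : N ⟶ K) (w : f ≫ g = 0) (hf : Function.Injective f.lin)
    (hg : Function.Surjective g.lin) (hfg : ∀ y, g.lin y = 0 → y ∈ LinearMap.range f.lin)
    (h₂ : LocalCohomologyVanishes I hI i N k) (h₁ : LocalCohomologyVanishes I hI (i + 1) M k) :
    LocalCohomologyVanishes I hI i K k :=
  iff_indExtVanishes.2 (.right (GrMod.shortExact_mk (GrMod.Hom.shift f k) (GrMod.Hom.shift g k)
    (GrMod.hom_ext fun x => congrArg (fun t : M ⟶ K => t.lin x) w) hf hg hfg)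
    (iff_indExtVanishes.1 h₂) (iff_indExtVanishes.1 h₁))

theorem prod (h₁ : LocalCohomologyVanishes I hI i M k) (h₂ : LocalCohomologyVanishes I hI i N k) :
    LocalCohomologyVanishes I hI i (M.prod N) k :=
  middle (N := M.prod N) ⟨LinearMap.inl R _ _, fun k _ h => ⟨h, zero_mem (N.piece k)⟩⟩
    ⟨LinearMap.snd R _ _, fun _ _ h => h.2⟩ rfl LinearMap.inl_injective LinearMap.snd_surjective
    (fun y hy => ⟨y.1, Prod.ext rfl (Eq.symm hy)⟩) h₁ h₂

end LocalCohomologyVanishes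

end LocalCohomology

/-! ### Graded modules killed by the ideal -/

namespace GrMod

variable {ι : Type} [AddCommGroup ι] [DecidableEq ι] {A : Type v} {R : Type u} [CommRing A]
  [CommRing R] [Algebra A R] {𝓡 : ι → Submodule A R} [GradedAlgebra 𝓡] {X N K : GrMod 𝓡}

/-- The morphism `R(b) ⟶ X` that sends `1` to a given element of degree `-b`. -/
def homOfMem (b : ι) (x : X.carrier) (hx : x ∈ X.piece (-b)) : (self 𝓡).shift b ⟶ X where
  lin := LinearMap.toSpanSingleton R X.carrier x
  map_mem k r hr := by
    have := X.smul_mem (k + b) (-b) r x hr hx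
    rwa [add_neg_cancel_right] at this

theorem one_mem_shift (b : ι) : (1 : R) ∈ ((self 𝓡).shift b).piece (-b) := by
  change (1 : R) ∈ 𝓡 (-b + b)
  rw [neg_add_cancel]
  exact SetLike.one_mem_graded 𝓡

instance projective_self_shift (b : ι) : Projective ((self 𝓡).shift b) where
  factors {E Y} f e _ := by
    obtain ⟨y, hy⟩ := surjective_of_epi e (f.lin (1 : R))
    refine ⟨homOfMem b (E.proj (-b) y) (internalProj_mem _ _ _), hom_ext fun (r : R) => ?_⟩
    change e.lin (r • E.proj (-b) y) = f.lin r
    rw [map_smul, lin_proj, hy,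
      (mem_piece_iff _ _ _).1 (f.map_mem (-b) (1 : R) (one_mem_shift b)), ← map_smul]
    exact congrArg f.lin (mul_one r)

/-- The isomorphism `R ≅ R(0)`. -/
def selfIso (𝓡 : ι → Submodule A R) [GradedAlgebra 𝓡] : self 𝓡 ≅ (self 𝓡).shift 0 where
  hom := ⟨LinearMap.id, fun k x hx => by
    change x ∈ 𝓡 (k + 0)
    rw [add_zero]
    exact hx⟩
  inv := ⟨LinearMap.id, fun k x hx => by
    change x ∈ 𝓡 (k + 0) at hx
    rw [add_zero] at hx
    exact hx⟩
  hom_inv_id := rfl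
  inv_hom_id := rfl

instance projective_self : Projective (self 𝓡) :=
  Projective.of_iso (selfIso 𝓡).symm inferInstance

theorem projective_prod (P Q : GrMod 𝓡) [Projective P] [Projective Q] :
    Projective (P.prod Q) where
  factors {E Y} f e _ := by
    let inl : P ⟶ P.prod Q := ⟨LinearMap.inl R _ _, fun k _ h => ⟨h, zero_mem (Q.piece k)⟩⟩
    let inr : Q ⟶ P.prod Q := ⟨LinearMap.inr R _ _, fun k _ h => ⟨zero_mem (P.piece k), h⟩⟩
    refine ⟨⟨(Projective.factorThru (inl ≫ f) e).lin.coprod (Projective.factorThru (inr ≫ f) e).lin,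
      fun k x hx => add_mem (Hom.map_mem _ k _ hx.1) (Hom.map_mem _ k _ hx.2)⟩,
      hom_ext fun (x : P.carrier × Q.carrier) => ?_⟩
    have h₁ := congrArg (fun t : P ⟶ Y => t.lin x.1) (Projective.factorThru_comp (inl ≫ f) e)
    have h₂ := congrArg (fun t : Q ⟶ Y => t.lin x.2) (Projective.factorThru_comp (inr ≫ f) e)
    change e.lin ((Projective.factorThru (inl ≫ f) e).lin x.1 +
      (Projective.factorThru (inr ≫ f) e).lin x.2) = f.lin x
    rw [map_add]
    refine (congrArg₂ (· + ·) h₁ h₂).trans ?_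
    change f.lin (x.1, 0) + f.lin (0, x.2) = f.lin x
    rw [← map_add, Prod.mk_add_mk, add_zero, zero_add]

/-- Finitely many homogeneous elements lie in the image of a finitely generated projective, built as
a direct sum of shifts of the ring. -/
theorem exists_projective_of_finset (s : Finset X.carrier)
    (hs : ∀ x ∈ s, ∃ k, x ∈ X.piece k) :
    ∃ (P : GrMod 𝓡) (f : P ⟶ X), Projective P ∧ Module.Finite R P.carrier ∧
      ∀ x ∈ s, x ∈ LinearMap.range f.lin := by
  classical
  induction s using Finset.induction_on with
  | empty =>
    refine ⟨zeroObj 𝓡, 0, ?_, ?_, by simp⟩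
    · exact (isZero_of_subsingleton (inferInstanceAs (Subsingleton PUnit))).projective
    · exact inferInstanceAs (Module.Finite R PUnit.{u+1})
  | insert x s hx ih =>
    obtain ⟨P, f, _, _, hf⟩ := ih fun y hy => hs y (Finset.mem_insert_of_mem hy)
    obtain ⟨k, hk⟩ := hs x (Finset.mem_insert_self x s)
    let g : (self 𝓡).shift (-k) ⟶ X := homOfMem (-k) x (by rwa [neg_neg])
    refine ⟨P.prod ((self 𝓡).shift (-k)), ⟨f.lin.coprod g.lin, fun l y hy =>
      add_mem (f.map_mem l _ hy.1) (g.map_mem l _ hy.2)⟩, projective_prod _ _,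
      inferInstanceAs (Module.Finite R (P.carrier × R)), fun y hy => ?_⟩
    rw [Finset.mem_insert] at hy
    rcases hy with rfl | hy
    · refine ⟨((0 : P.carrier), (1 : R)), ?_⟩
      change f.lin 0 + (1 : R) • y = y
      rw [map_zero, zero_add, one_smul]
    · obtain ⟨z, rfl⟩ := hf y hy
      refine ⟨(z, (0 : R)), ?_⟩
      change f.lin z + (0 : R) • x = f.lin z
      rw [zero_smul, add_zero]

theorem exists_projective_surjective (X : GrMod 𝓡) [Module.Finite R X.carrier] :
    ∃ (P : GrMod 𝓡) (f : P ⟶ X), Projective P ∧ Module.Finite R P.carrier ∧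
      Function.Surjective f.lin := by
  classical
  obtain ⟨s, hs⟩ := Module.finite_def.1 (inferInstance : Module.Finite R X.carrier)
  choose t ht using fun x => internalProj_sum X.isInternal x
  obtain ⟨P, f, h₁, h₂, h₃⟩ := exists_projective_of_finset (X := X)
    (s.biUnion fun x => (t x).image fun i => internalProj X.isInternal i x) (by
      intro y hy
      simp only [Finset.mem_biUnion, Finset.mem_image] at hy
      obtain ⟨x, -, i, -, rfl⟩ := hy
      exact ⟨i, internalProj_mem _ _ _⟩)
  refine ⟨P, f, h₁, h₂, LinearMap.range_eq_top.1 (top_le_iff.1 ?_)⟩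
  rw [← hs, Submodule.span_le]
  intro x hx
  rw [← ht x]
  refine Submodule.sum_mem _ fun i hi => h₃ _ ?_
  simp only [Finset.mem_biUnion, Finset.mem_image]
  exact ⟨x, hx, i, hi, rfl⟩

/-- For a homogeneous ideal `J`, the submodule `J X` of a graded module `X` is stable under the
projections. -/
theorem smul_top_stable (X : GrMod 𝓡) (J : Ideal R) (hJ : J.IsHomogeneous 𝓡) (k : ι)
    (x : X.carrier) (hx : x ∈ J • (⊤ : Submodule R X.carrier)) :
    X.proj k x ∈ J • (⊤ : Submodule R X.carrier) := by
  induction hx using Submodule.smul_induction_on' with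
  | smul r hr m _ =>
    obtain ⟨s, hs⟩ := internalProj_sum (self 𝓡).isInternal r
    obtain ⟨t, ht⟩ := internalProj_sum X.isInternal m
    rw [← hs, ← ht, Finset.sum_smul_sum, map_sum]
    refine Submodule.sum_mem _ fun a _ => ?_
    rw [map_sum]
    refine Submodule.sum_mem _ fun b _ => ?_
    have hdeg := X.smul_mem a b _ _ (internalProj_mem (self 𝓡).isInternal a r)
      (internalProj_mem X.isInternal b m)
    by_cases h : a + b = k
    · subst h
      rw [(mem_piece_iff _ _ _).1 hdeg]
      exact Submodule.smul_mem_smul (stable_of_isHomogeneous 𝓡 J hJ a r hr) trivial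
    · have h0 := internalProj_ne X.isInternal _ _ _ hdeg h
      change X.proj k _ = 0 at h0
      rw [h0]
      exact zero_mem _
  | add x _ y _ hx hy =>
    rw [map_add]
    exact add_mem hx hy

/-- The graded submodule `J X`. -/
abbrev smulTop (X : GrMod 𝓡) (J : Ideal R) (hJ : J.IsHomogeneous 𝓡) : GrMod 𝓡 :=
  X.sub (J • ⊤) (X.smul_top_stable J hJ)

/-- The inclusion of a graded submodule. -/
def subι (X : GrMod 𝓡) (L : Submodule R X.carrier) (hL : ∀ k x, x ∈ L → X.proj k x ∈ L) :
    X.sub L hL ⟶ X :=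
  ⟨L.subtype, fun _ _ h => h⟩

/-- The restriction of a morphism to graded submodules. -/
def subMap (f : X ⟶ N) {L : Submodule R X.carrier} (hL : ∀ k x, x ∈ L → X.proj k x ∈ L)
    {L' : Submodule R N.carrier} (hL' : ∀ k x, x ∈ L' → N.proj k x ∈ L')
    (h : ∀ x ∈ L, f.lin x ∈ L') : X.sub L hL ⟶ N.sub L' hL' :=
  ⟨f.lin.restrict h, fun k x hx => f.map_mem k x.1 hx⟩

end GrMod

theorem mk_mem_smul_top {R M : Type*} [CommRing R] [AddCommGroup M] [Module R M]
    {J : Ideal R} {L : Submodule R M} {x : M} (hx : x ∈ J • L) (hxL : x ∈ L) :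
    (⟨x, hxL⟩ : L) ∈ J • (⊤ : Submodule R L) := by
  have h : (J • (⊤ : Submodule R L)).map L.subtype = J • L := by
    rw [Submodule.map_smul'', Submodule.map_subtype_top]
  rw [← h] at hx
  obtain ⟨y, hy, rfl⟩ := hx
  exact hy

section Torsion

variable {ι : Type} [AddCommGroup ι] [DecidableEq ι] {A : Type v} {R : Type u} [CommRing A]
  [CommRing R] [Algebra A R] {𝓡 : ι → Submodule A R} [GradedAlgebra 𝓡]
  {I : Ideal R} (hI : I.IsHomogeneous 𝓡)

open Abelian (Ext)
open GrMod

/-- An extension class of a finitely generated graded module `X` by a graded module killed by `I`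
dies on `I ^ n X` for some `n`. Dimension shifting along a surjection from a finitely generated
projective reduces to morphisms; the Artin–Rees lemma compares the `I`-adic filtrations of the
projective and of its syzygy. -/
theorem exists_ext_restrict_eq_zero [IsNoetherianRing R] (T : GrMod 𝓡)
    (hT : ∀ r ∈ I, ∀ t : T.carrier, r • t = 0) (i : ℕ) (X : GrMod 𝓡) [Module.Finite R X.carrier]
    (e : Ext X T i) : ∃ n : ℕ, (Ext.mk₀ (X.subι (I ^ n • ⊤)
      (X.smul_top_stable (I ^ n) (isHomogeneous_pow 𝓡 I hI n)))).comp e (zero_add i) = 0 := by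
  induction i generalizing X with
  | zero =>
    refine ⟨1, ?_⟩
    obtain ⟨φ, rfl⟩ := (Ext.mk₀_bijective X T).2 e
    rw [Ext.mk₀_comp_mk₀, Ext.mk₀_eq_zero_iff]
    ext ⟨x, hx⟩
    change φ.lin x = 0
    rw [pow_one] at hx
    induction hx using Submodule.smul_induction_on' with
    | smul r hr m _ => rw [map_smul, hT r hr]
    | add x _ y _ hx hy => rw [map_add, hx, hy, add_zero]
  | succ i ih =>
    obtain ⟨P, f, _, _, hf⟩ := X.exists_projective_surjective
    have hS : (ShortComplex.mk (kerι f) f (kerι_comp f)).ShortExact :=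
      shortExact_mk _ _ _ Subtype.val_injective hf (fun y hy => ⟨⟨y, hy⟩, rfl⟩)
    obtain ⟨e, rfl⟩ := Ext.contravariant_sequence_exact₃ hS T e
      (Ext.eq_zero_of_projective _) (add_comm 1 i)
    have : Module.Finite R (P.sub (LinearMap.ker f.lin) (ker_stable f)).carrier :=
      inferInstanceAs (Module.Finite R (LinearMap.ker f.lin))
    obtain ⟨n, hn⟩ := ih _ e
    obtain ⟨c, hc⟩ := Ideal.exists_pow_inf_eq_pow_smul I (LinearMap.ker f.lin)
    refine ⟨n + c, ?_⟩
    have hm := isHomogeneous_pow 𝓡 I hI (n + c)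
    have hmap : (I ^ (n + c) • (⊤ : Submodule R P.carrier)).map f.lin =
        I ^ (n + c) • (⊤ : Submodule R X.carrier) := by
      rw [Submodule.map_smul'', Submodule.map_top, LinearMap.range_eq_top.2 hf]
    let f' : P.smulTop (I ^ (n + c)) hm ⟶ X.smulTop (I ^ (n + c)) hm :=
      subMap f _ _ (fun x hx => hmap ▸ Submodule.mem_map_of_mem hx)
    have hf' : Function.Surjective f'.lin := by
      rintro ⟨y, hy⟩
      rw [← hmap] at hy
      obtain ⟨x, hx, rfl⟩ := hy
      exact ⟨⟨x, hx⟩, rfl⟩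
    have hS' : (ShortComplex.mk (kerι f') f' (kerι_comp f')).ShortExact :=
      shortExact_mk _ _ _ Subtype.val_injective hf' (fun y hy => ⟨⟨y, hy⟩, rfl⟩)
    have hker : ∀ x : (P.smulTop (I ^ (n + c)) hm).carrier, x ∈ LinearMap.ker f'.lin →
        x.1 ∈ LinearMap.ker f.lin := fun x hx => congrArg Subtype.val hx
    -- the inclusion of the syzygies factors through `I ^ n` times the syzygy, by Artin–Rees
    let σ : (P.smulTop (I ^ (n + c)) hm).sub (LinearMap.ker f'.lin) (ker_stable f') ⟶
        (P.sub (LinearMap.ker f.lin) (ker_stable f)).smulTop (I ^ n)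
          (isHomogeneous_pow 𝓡 I hI n) :=
      ⟨{ toFun := fun x => ⟨⟨x.1.1, hker _ x.2⟩, by
          refine mk_mem_smul_top ?_ _
          have := hc (n + c) (Nat.le_add_left _ _)
          rw [Nat.add_sub_cancel] at this
          have hx : x.1.1 ∈ I ^ (n + c) • ⊤ ⊓ LinearMap.ker f.lin := ⟨x.1.2, hker _ x.2⟩
          rw [this] at hx
          exact Submodule.smul_mono le_rfl inf_le_right hx⟩
         map_add' := fun _ _ => rfl
         map_smul' := fun _ _ => rfl }, fun k x hx => hx⟩
    let φ : ShortComplex.mk (kerι f') f' (kerι_comp f') ⟶ ShortComplex.mk (kerι f) f (kerι_comp f) :=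
      { τ₁ := σ ≫ subι _ _ _
        τ₂ := P.subι _ (P.smul_top_stable _ hm)
        τ₃ := X.subι _ (X.smul_top_stable _ hm)
        comm₁₂ := rfl
        comm₂₃ := rfl }
    have key : (Ext.mk₀ (σ ≫ subι _ _ _)).comp e (zero_add i) = 0 := by
      rw [← Ext.mk₀_comp_mk₀_assoc, hn, Ext.comp_zero]
    exact mk₀_comp_extClass_comp_eq_zero hS' hS φ e (add_comm 1 i) key

/-- The exact sequence `0 ⟶ I ^ n ⟶ R ⟶ R / I ^ n ⟶ 0` of graded modules. -/
def powSequence (n : ℕ) : ShortComplex (GrMod 𝓡) :=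
  ShortComplex.mk
    ((self 𝓡).subι (I ^ n) (stable_of_isHomogeneous 𝓡 _ (isHomogeneous_pow 𝓡 I hI n)))
    (X₂ := self 𝓡) (X₃ := (quotPow 𝓡 I hI).obj (.op n))
    ⟨(I ^ n).mkQ, fun _ x h => ⟨x, h, rfl⟩⟩
    (hom_ext fun x => (Submodule.Quotient.mk_eq_zero _).2 x.2)

theorem powSequence_shortExact (n : ℕ) : (powSequence hI n).ShortExact :=
  shortExact_mk _ _ _ Subtype.val_injective (Submodule.mkQ_surjective _)
    (fun y hy => ⟨⟨y, (Submodule.Quotient.mk_eq_zero _).1 hy⟩, rfl⟩)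

/-- The local cohomology with support in `I` of a graded module killed by `I` vanishes in
positive cohomological degrees. -/
theorem LocalCohomologyVanishes.of_smul_eq_zero [IsNoetherianRing R] (T : GrMod 𝓡)
    (hT : ∀ r ∈ I, ∀ t : T.carrier, r • t = 0) (i : ℕ) (k : ι) :
    LocalCohomologyVanishes I hI (i + 1) T k := by
  rw [iff_indExtVanishes]
  intro n e
  obtain ⟨e, rfl⟩ := Ext.contravariant_sequence_exact₃ (powSequence_shortExact hI n) _ e
    (haveI : Projective (powSequence hI n).X₂ := projective_self (𝓡 := 𝓡)
     Ext.eq_zero_of_projective _) (add_comm 1 i)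
  have : Module.Finite R (powSequence hI n).X₁.carrier :=
    inferInstanceAs (Module.Finite R (I ^ n : Ideal R))
  obtain ⟨m, hm⟩ := exists_ext_restrict_eq_zero hI (T.shift k) hT i _ e
  refine ⟨m + n, Nat.le_add_left _ _, ?_⟩
  let σ : (powSequence hI (m + n)).X₁ ⟶ (powSequence hI n).X₁.smulTop (I ^ m)
      (isHomogeneous_pow 𝓡 I hI m) :=
    ⟨{ toFun := fun x => ⟨⟨x.1, Ideal.pow_le_pow_right (Nat.le_add_left n m) x.2⟩, by
        exact mk_mem_smul_top ((pow_add I m n).le x.2) _⟩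
       map_add' := fun _ _ => rfl
       map_smul' := fun _ _ => rfl }, fun k x hx => hx⟩
  let φ : powSequence hI (m + n) ⟶ powSequence hI n :=
    { τ₁ := σ ≫ subι _ _ _
      τ₂ := 𝟙 (self 𝓡)
      τ₃ := (quotPow 𝓡 I hI).map (homOfLE (Nat.le_add_left n m)).op
      comm₁₂ := rfl
      comm₂₃ := rfl }
  have key : (Ext.mk₀ (σ ≫ subι _ _ _)).comp e (zero_add i) = 0 := by
    rw [← Ext.mk₀_comp_mk₀_assoc, hm, Ext.comp_zero]
  exact mk₀_comp_extClass_comp_eq_zero (powSequence_shortExact hI (m + n))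
    (powSequence_shortExact hI n) φ e (add_comm 1 i) key

/-- A graded module killed by `I` is its own `0`-th local cohomology with support in `I`, so it has
no elements in the degrees in which the latter vanishes. -/
theorem LocalCohomologyVanishes.eq_zero_of_smul_eq_zero (T : GrMod 𝓡)
    (hT : ∀ r ∈ I, ∀ t : T.carrier, r • t = 0) {k : ι}
    (h : LocalCohomologyVanishes I hI 0 T k) (t : T.carrier) (ht : t ∈ T.piece k) : t = 0 := by
  let g : self 𝓡 ⟶ T.shift k :=
    ⟨LinearMap.toSpanSingleton R T.carrier t, fun a r hr => T.smul_mem a k r t hr ht⟩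
  obtain ⟨φ, hφ⟩ : ∃ φ : (quotPow 𝓡 I hI).obj (.op 1) ⟶ T.shift k,
      (powSequence hI 1).g ≫ φ = g :=
    exists_desc (powSequence hI 1).g (Submodule.mkQ_surjective _) g (fun r hr =>
      hT r (pow_one I ▸ (Submodule.Quotient.mk_eq_zero _).1 hr) t)
  obtain ⟨m, hm, h0⟩ := iff_indExtVanishes.1 h 1 (Ext.mk₀ φ)
  rw [Ext.mk₀_comp_mk₀, Ext.mk₀_eq_zero_iff] at h0
  have h1 := congrArg (fun q : _ ⟶ T.shift k => q.lin ((I ^ m).mkQ (1 : R))) h0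
  have h2 := congrArg (fun q : self 𝓡 ⟶ T.shift k => q.lin (1 : R)) hφ
  exact (one_smul R t).symm.trans (h2.symm.trans h1)

end Torsion

/-! ### Koszul complexes -/

section Koszul

variable {ι : Type} [AddCommGroup ι] [DecidableEq ι] {A : Type v} {R : Type u} [CommRing A]
  [CommRing R] [Algebra A R] {𝓡 : ι → Submodule A R} [GradedAlgebra 𝓡]

/-- What is needed of the Koszul complex of the list `l` of homogeneous elements of degree `a` on
a graded module `obj 0`: a bounded complex of graded modules in which every element of `l` is null
homotopic, whose image in `obj 0` consists of combinations of elements of `l`, and whose `j`-th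
term is a sum of copies of `(obj 0)(-j a)`. The last property enters only through the vanishing of
local cohomology. The homotopies are not asked to respect the grading. -/
structure KoszulComplex (I : Ideal R) (hI : I.IsHomogeneous 𝓡) (a : ι) (l : List R) where
  /-- the terms -/
  obj : ℕ → GrMod 𝓡
  /-- the differentials -/
  d : ∀ j, obj (j + 1) ⟶ obj j
  d_comp_d : ∀ j x, (d j).lin ((d (j + 1)).lin x) = 0
  bounded : ∃ n, ∀ j, n < j → Subsingleton (obj j).carrier
  homotopy : ∀ r ∈ l, ∃ h : ∀ j, (obj j).carrier →ₗ[R] (obj (j + 1)).carrier,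
    (∀ y, (d 0).lin (h 0 y) = r • y) ∧
    ∀ j y, (d (j + 1)).lin (h (j + 1) y) + h j ((d j).lin y) = r • y
  d_zero_mem : ∀ k, ∀ y ∈ (obj 1).piece (k + a), (d 0).lin y ∈
    AddSubgroup.closure {z | ∃ r ∈ l, ∃ m ∈ (obj 0).piece k, r • m = z}
  vanishes : ∀ i k j, LocalCohomologyVanishes I hI i (obj 0) (k - j • a) →
    LocalCohomologyVanishes I hI i (obj j) k

namespace KoszulComplex

variable {I : Ideal R} {hI : I.IsHomogeneous 𝓡} {a : ι} {l : List R}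

open GrMod

/-- Multiplication by a homogeneous element of degree `a`. -/
def mulHom (N : GrMod 𝓡) (r : R) (hr : r ∈ 𝓡 a) : N.shift (-a) ⟶ N where
  lin := LinearMap.lsmul R N.carrier r
  map_mem k y hy := by
    have := N.smul_mem a (k + -a) r y hr hy
    rwa [add_comm k, add_neg_cancel_left] at this

/-- The Koszul complex of the empty list. -/
def nil (M : GrMod 𝓡) : KoszulComplex I hI a [] where
  obj | 0 => M
      | _ + 1 => zeroObj 𝓡
  d _ := 0
  d_comp_d _ _ := rfl
  bounded := ⟨0, fun j hj => by
    obtain ⟨j, rfl⟩ := Nat.exists_eq_succ_of_ne_zero hj.ne'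
    exact inferInstanceAs (Subsingleton PUnit)⟩
  homotopy r hr := by simp at hr
  d_zero_mem _ _ _ := zero_mem _
  vanishes i k j h := by
    cases j with
    | zero => simpa using h
    | succ j => exact .of_subsingleton (inferInstanceAs (Subsingleton PUnit))

/-- The terms of the mapping cone of the multiplication by an element of degree `a`. -/
def coneObj (K : ℕ → GrMod 𝓡) (a : ι) : ℕ → GrMod 𝓡
  | 0 => K 0
  | j + 1 => (K (j + 1)).prod ((K j).shift (-a))

/-- The differentials `(y, z) ↦ (d y + r z, -d z)` of the mapping cone of the multiplication by
`r`. -/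
def coneD (K : KoszulComplex I hI a l) (r : R) (hr : r ∈ 𝓡 a) :
    ∀ j, coneObj K.obj a (j + 1) ⟶ coneObj K.obj a j
  | 0 => ⟨(K.d 0).lin.coprod (mulHom (K.obj 0) r hr).lin, fun k _ hy =>
      add_mem ((K.d 0).map_mem k _ hy.1) ((mulHom (K.obj 0) r hr).map_mem k _ hy.2)⟩
  | j + 1 => ⟨((K.d (j + 1)).lin.coprod (mulHom (K.obj (j + 1)) r hr).lin).prod
      (-(K.d j).lin.comp (LinearMap.snd R _ _)), fun k _ hy =>
      ⟨add_mem ((K.d (j + 1)).map_mem k _ hy.1) ((mulHom (K.obj (j + 1)) r hr).map_mem k _ hy.2),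
        neg_mem (S := AddSubgroup (K.obj j).carrier) (s := (K.obj j).piece (k + -a))
          ((K.d j).map_mem (k + -a) _ hy.2)⟩⟩

/-- Adding an element to the list: the mapping cone of the multiplication by that element. -/
def cons (K : KoszulComplex I hI a l) (r : R) (hr : r ∈ 𝓡 a) : KoszulComplex I hI a (r :: l) where
  obj := coneObj K.obj a
  d := coneD K r hr
  d_comp_d j x := by
    cases j with
    | zero =>
      change (K.d 0).lin ((K.d 1).lin x.1 + r • x.2) + r • (-(K.d 0).lin x.2) = 0
      rw [map_add, K.d_comp_d, map_smul, smul_neg, zero_add, add_neg_cancel]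
    | succ j =>
      refine Prod.ext ?_ ?_
      · change (K.d (j + 1)).lin ((K.d (j + 2)).lin x.1 + r • x.2) +
          r • (-(K.d (j + 1)).lin x.2) = 0
        rw [map_add, K.d_comp_d, map_smul, smul_neg, zero_add, add_neg_cancel]
      · change -(K.d j).lin (-(K.d (j + 1)).lin x.2) = 0
        rw [map_neg, K.d_comp_d, neg_zero, neg_zero]
  bounded := by
    obtain ⟨n, hn⟩ := K.bounded
    refine ⟨n + 1, fun j hj => ?_⟩
    obtain ⟨j, rfl⟩ := Nat.exists_eq_succ_of_ne_zero (Nat.ne_zero_of_lt hj)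
    have h₁ := hn (j + 1) (by lia)
    have h₂ := hn j (by lia)
    exact inferInstanceAs (Subsingleton ((K.obj (j + 1)).carrier × (K.obj j).carrier))
  homotopy s hs := by
    rw [List.mem_cons] at hs
    rcases hs with rfl | hs
    · refine ⟨fun j => match j with
        | 0 => LinearMap.inr R (K.obj 1).carrier (K.obj 0).carrier
        | j + 1 => (LinearMap.inr R (K.obj (j + 2)).carrier (K.obj (j + 1)).carrier).comp
            (LinearMap.fst R (K.obj (j + 1)).carrier (K.obj j).carrier), fun y => ?_, fun j y => ?_⟩
      · change (K.d 0).lin 0 + s • (show (K.obj 0).carrier from y) = s • y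
        rw [map_zero]
        exact zero_add _
      · cases j with
        | zero =>
          refine Prod.ext ?_ ?_
          · change (K.d 1).lin 0 + s • y.1 + 0 = s • y.1
            rw [map_zero, zero_add, add_zero]
          · change -(K.d 0).lin y.1 + ((K.d 0).lin y.1 + s • y.2) = s • y.2
            rw [neg_add_cancel_left]
        | succ j =>
          refine Prod.ext ?_ ?_
          · change (K.d (j + 2)).lin 0 + s • y.1 + 0 = s • y.1
            rw [map_zero, zero_add, add_zero]
          · change -(K.d (j + 1)).lin y.1 + ((K.d (j + 1)).lin y.1 + s • y.2) = s • y.2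
            rw [neg_add_cancel_left]
    · obtain ⟨h, h0, hh⟩ := K.homotopy s hs
      refine ⟨fun j => match j with
        | 0 => (LinearMap.inl R (K.obj 1).carrier (K.obj 0).carrier).comp (h 0)
        | j + 1 => (h (j + 1)).prodMap (-(h j)), fun y => ?_, fun j y => ?_⟩
      · change (K.d 0).lin (h 0 y) + r • (0 : (K.obj 0).carrier) = s • y
        rw [smul_zero]
        exact (add_zero _).trans (h0 y)
      · cases j with
        | zero =>
          refine Prod.ext ?_ ?_
          · change (K.d 1).lin (h 1 y.1) + r • (-h 0 y.2) + h 0 ((K.d 0).lin y.1 + r • y.2) =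
              s • y.1
            rw [← hh 0 y.1, map_add, map_smul, smul_neg]
            abel
          · change -(K.d 0).lin (-h 0 y.2) + 0 = s • y.2
            rw [map_neg, neg_neg, h0, add_zero]
        | succ j =>
          refine Prod.ext ?_ ?_
          · change (K.d (j + 2)).lin (h (j + 2) y.1) + r • (-h (j + 1) y.2) +
              h (j + 1) ((K.d (j + 1)).lin y.1 + r • y.2) = s • y.1
            rw [← hh (j + 1) y.1, map_add, map_smul, smul_neg]
            abel
          · change -(K.d (j + 1)).lin (-h (j + 1) y.2) + -h j (-(K.d j).lin y.2) = s • y.2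
            rw [map_neg, map_neg, neg_neg, neg_neg, hh]
  d_zero_mem k y hy := by
    have hle : AddSubgroup.closure {z | ∃ r ∈ l, ∃ m ∈ (K.obj 0).piece k, r • m = z} ≤
        AddSubgroup.closure {z | ∃ s ∈ r :: l, ∃ m ∈ (K.obj 0).piece k, s • m = z} :=
      AddSubgroup.closure_mono fun z ⟨s, hs, m, hm, h⟩ => ⟨s, List.mem_cons_of_mem r hs, m, hm, h⟩
    refine add_mem (hle (K.d_zero_mem k y.1 hy.1)) (AddSubgroup.subset_closure
      ⟨r, List.mem_cons_self, y.2, ?_, rfl⟩)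
    have := hy.2
    change y.2 ∈ (K.obj 0).piece (k + a + -a) at this
    rwa [add_neg_cancel_right] at this
  vanishes i k j h := by
    cases j with
    | zero => simpa using h
    | succ j =>
      refine .prod (K.vanishes i k (j + 1) h) (LocalCohomologyVanishes.shift_iff.2
        (K.vanishes i _ j ?_))
      rwa [succ_nsmul', ← sub_sub, sub_eq_add_neg k a] at h

end KoszulComplex

theorem exists_koszulComplex (I : Ideal R) (hI : I.IsHomogeneous 𝓡) (a : ι) (l : List R)
    (hl : ∀ r ∈ l, r ∈ 𝓡 a) (M : GrMod 𝓡) : ∃ K : KoszulComplex I hI a l, K.obj 0 = M := by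
  induction l with
  | nil => exact ⟨.nil M, rfl⟩
  | cons r l ih =>
    obtain ⟨K, hK⟩ := ih fun s hs => hl s (List.mem_cons_of_mem r hs)
    exact ⟨K.cons r (hl r List.mem_cons_self), hK⟩

end Koszul

/-! ### Propagation of vanishing along Koszul complexes -/

section Regularity

variable {ι : Type} [AddCommGroup ι] [DecidableEq ι] {A : Type v} {R : Type u} [CommRing A]
  [CommRing R] [Algebra A R] {𝓡 : ι → Submodule A R} [GradedAlgebra 𝓡]
  {I : Ideal R} {hI : I.IsHomogeneous 𝓡} {a : ι} {l : List R}

open GrMod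

theorem smul_quot_eq_zero_of_le_span {M : Type*} [AddCommGroup M] [Module R M]
    {I : Ideal R} {l : List R} (hIl : I ≤ Ideal.span {r | r ∈ l}) (L : Submodule R M)
    (h : ∀ r ∈ l, ∀ y : M, r • y ∈ L) : ∀ r ∈ I, ∀ t : M ⧸ L, r • t = 0 := by
  intro r hr t
  obtain ⟨y, rfl⟩ := L.mkQ_surjective t
  rw [← map_smul, Submodule.mkQ_apply, Submodule.Quotient.mk_eq_zero]
  have hle : Ideal.span {r | r ∈ l} ≤ L.comap (LinearMap.toSpanSingleton R M y) :=
    Submodule.span_le.2 fun s hs => h s hs y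
  exact hle (hIl hr)

namespace KoszulComplex

variable (K : KoszulComplex I hI a l)

/-- The image of a differential. -/
abbrev boundaries (j : ℕ) : GrMod 𝓡 :=
  (K.obj j).sub (LinearMap.range (K.d j).lin) (range_stable (K.d j))

/-- The kernel of a differential. -/
abbrev cycles (j : ℕ) : GrMod 𝓡 :=
  (K.obj (j + 1)).sub (LinearMap.ker (K.d j).lin) (ker_stable (K.d j))

theorem boundaries_vanish_of_cycles_vanish {i j : ℕ} {k : ι}
    (h₁ : LocalCohomologyVanishes I hI i (K.obj (j + 1)) k)
    (h₂ : LocalCohomologyVanishes I hI (i + 1) (K.cycles j) k) :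
    LocalCohomologyVanishes I hI i (K.boundaries j) k := by
  let g : K.obj (j + 1) ⟶ K.boundaries j :=
    ⟨(K.d j).lin.rangeRestrict, fun k x hx => (K.d j).map_mem k x hx⟩
  refine .right (kerι (K.d j)) g ?_ Subtype.val_injective (K.d j).lin.surjective_rangeRestrict
    (fun y hy => ⟨⟨y, congrArg Subtype.val hy⟩, rfl⟩) h₁ h₂
  ext x
  exact x.2

variable [IsNoetherianRing R] (hIl : I ≤ Ideal.span {r | r ∈ l})

include hIl

/-- The homology is killed by `I`, so boundaries and cycles have the same local cohomology in
cohomological degrees at least `2`; only one direction is needed. -/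
theorem cycles_vanish_of_boundaries_vanish {i j : ℕ} {k : ι}
    (h : LocalCohomologyVanishes I hI (i + 1) (K.boundaries (j + 1)) k) :
    LocalCohomologyVanishes I hI (i + 1) (K.cycles j) k := by
  let f : K.boundaries (j + 1) ⟶ K.cycles j :=
    subMap (𝟙 (K.obj (j + 1))) _ _ (by rintro _ ⟨x, rfl⟩; exact K.d_comp_d j x)
  have hf : Function.Injective f.lin := fun x y hxy => Subtype.ext
    (congrArg (fun z : (K.cycles j).carrier => (z.1 : (K.obj (j + 1)).carrier)) hxy)
  refine .middle f (cokerπ f) (comp_cokerπ f) hf (Submodule.mkQ_surjective _)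
    (fun y hy => (Submodule.Quotient.mk_eq_zero _).1 hy) h
    (.of_smul_eq_zero hI _ (smul_quot_eq_zero_of_le_span hIl _ ?_) i k)
  rintro r hr ⟨y, hy⟩
  obtain ⟨s, -, hs⟩ := K.homotopy r hr
  have hy' := hs j y
  rw [LinearMap.mem_ker.1 hy, map_zero, add_zero] at hy'
  exact ⟨⟨_, ⟨s (j + 1) y, rfl⟩⟩, Subtype.ext hy'⟩

/-- Descending along the complex: the boundaries in `K_j` have no `H^i` if the terms `K_{j+1+m}`
have no `H^{i+m}`. -/
theorem boundaries_vanish {i : ℕ} {k : ι} (j : ℕ)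
    (h : ∀ m, LocalCohomologyVanishes I hI (i + m) (K.obj (j + m + 1)) k) :
    LocalCohomologyVanishes I hI i (K.boundaries j) k := by
  obtain ⟨n, hn⟩ := K.bounded
  -- descending induction on `j`, starting from the vanishing of the terms beyond `n`
  obtain ⟨c, hc⟩ : ∃ c, n < j + c := ⟨n + 1, by lia⟩
  induction c generalizing i j with
  | zero =>
    have := hn j hc
    exact .of_subsingleton (inferInstanceAs (Subsingleton (LinearMap.range (K.d j).lin)))
  | succ c ih =>
    refine K.boundaries_vanish_of_cycles_vanish (h 0)
      (K.cycles_vanish_of_boundaries_vanish hIl (ih (j + 1) (fun m => ?_) (by lia)))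
    have := h (m + 1)
    rwa [show i + (m + 1) = i + 1 + m by lia, show j + (m + 1) + 1 = j + 1 + m + 1 by lia] at this

/-- The cokernel of the last differential is killed by `I`. -/
theorem smul_quot_boundaries (r : R) (hr : r ∈ I)
    (t : (K.obj 0).carrier ⧸ LinearMap.range (K.d 0).lin) : r • t = 0 := by
  refine smul_quot_eq_zero_of_le_span hIl _ (fun s hs y => ?_) r hr t
  obtain ⟨h, h0, -⟩ := K.homotopy s hs
  exact ⟨h 0 y, h0 y⟩

theorem boundaries_zero_vanish {i : ℕ} {k : ι}
    (h : ∀ j : ℕ, LocalCohomologyVanishes I hI (i + j) (K.obj 0) (k - j • a)) :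
    LocalCohomologyVanishes I hI i (K.boundaries 0) (k + a) := by
  refine K.boundaries_vanish hIl 0 fun m => ?_
  rw [zero_add]
  refine K.vanishes _ _ _ ?_
  rw [succ_nsmul, ← sub_sub, sub_right_comm, add_sub_cancel_right]
  exact h m

end KoszulComplex

variable [IsNoetherianRing R] (hl : ∀ r ∈ l, r ∈ 𝓡 a) (hIl : I ≤ Ideal.span {r | r ∈ l})

include hl hIl

/-- Vanishing of local cohomology propagates by one step in the degree of the elements of `l`, if
these generate an ideal that contains `I`. -/
theorem localCohomologyVanishes_add (M : GrMod 𝓡) (i : ℕ) (k : ι)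
    (h : ∀ j : ℕ, LocalCohomologyVanishes I hI (i + 1 + j) M (k - j • a)) :
    LocalCohomologyVanishes I hI (i + 1) M (k + a) := by
  obtain ⟨K, rfl⟩ := exists_koszulComplex I hI a l hl M
  exact .middle ((K.obj 0).subι _ (range_stable (K.d 0))) (cokerπ (K.d 0))
    (hom_ext fun x => (Submodule.Quotient.mk_eq_zero _).2 x.2)
    Subtype.val_injective (Submodule.mkQ_surjective _)
    (fun y hy => ⟨⟨y, (Submodule.Quotient.mk_eq_zero _).1 hy⟩, rfl⟩)
    (K.boundaries_zero_vanish hIl h)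
    (.of_smul_eq_zero hI _ (K.smul_quot_boundaries hIl) i _)

/-- Under the vanishing that makes `H^1_I(M)_{k+a}` vanish, together with `H^0_I(M)_{k+a} = 0`, the
elements of `l` and the piece of degree `k` generate the piece of degree `k + a`. -/
theorem mem_closure_of_vanishes (M : GrMod 𝓡) (k : ι)
    (h₀ : LocalCohomologyVanishes I hI 0 M (k + a))
    (h : ∀ j : ℕ, LocalCohomologyVanishes I hI (1 + j) M (k - j • a))
    (x : M.carrier) (hx : x ∈ M.piece (k + a)) :
    x ∈ AddSubgroup.closure {z | ∃ r ∈ l, ∃ m ∈ M.piece k, r • m = z} := by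
  obtain ⟨K, rfl⟩ := exists_koszulComplex I hI a l hl M
  have hq : LocalCohomologyVanishes I hI 0
      ((K.obj 0).quot (LinearMap.range (K.d 0).lin) (range_stable (K.d 0))) (k + a) :=
    .right ((K.obj 0).subι _ (range_stable (K.d 0))) (cokerπ (K.d 0))
      (hom_ext fun x => (Submodule.Quotient.mk_eq_zero _).2 x.2)
      Subtype.val_injective (Submodule.mkQ_surjective _)
      (fun y hy => ⟨⟨y, (Submodule.Quotient.mk_eq_zero _).1 hy⟩, rfl⟩) h₀
      (K.boundaries_zero_vanish hIl h)
  have h0 := hq.eq_zero_of_smul_eq_zero hI _ (K.smul_quot_boundaries hIl)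
    ((LinearMap.range (K.d 0).lin).mkQ x) ⟨x, hx, rfl⟩
  obtain ⟨y, hy⟩ := (Submodule.Quotient.mk_eq_zero _).1 h0
  rw [← (mem_piece_iff _ _ _).1 hx, ← hy, ← lin_proj]
  exact K.d_zero_mem k _ (internalProj_mem _ _ _)

end Regularity

/-! ### Generators and staircases -/

section Generators

variable {ι : Type} [AddCommGroup ι] [DecidableEq ι] {A : Type v} {R : Type u} [CommRing A]
  [CommRing R] [Algebra A R] {𝓡 : ι → Submodule A R} [GradedAlgebra 𝓡]

/-- Let `R` be generated by elements of degree `a` and elements of degree `0` for a coarser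
grading `φ`. Then the elements of nonzero `φ`-degree lie in the ideal of the former generators. -/
theorem mem_span_of_generators {s : Set R} (hs : Algebra.adjoin A s = ⊤) {a : ι} (φ : ι →+ ℤ)
    (hdeg : ∀ r ∈ s, r ∈ 𝓡 a ∨ ∃ c, φ c = 0 ∧ r ∈ 𝓡 c) {c : ι} (hc : φ c ≠ 0) {r : R}
    (hr : r ∈ 𝓡 c) : r ∈ Ideal.span {x | x ∈ s ∧ x ∈ 𝓡 a} := by
  set J := Ideal.span {x | x ∈ s ∧ x ∈ 𝓡 a}
  have hmon : ∀ m ∈ Submonoid.closure s, ∃ b, m ∈ 𝓡 b ∧ (m ∈ J ∨ φ b = 0) := by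
    intro m hm
    induction hm using Submonoid.closure_induction with
    | mem x hx =>
      rcases hdeg x hx with h | ⟨b, hb, h⟩
      · exact ⟨a, h, .inl (Ideal.subset_span ⟨hx, h⟩)⟩
      · exact ⟨b, h, .inr hb⟩
    | one => exact ⟨0, SetLike.one_mem_graded 𝓡, .inr (map_zero φ)⟩
    | mul x y _ _ hx hy =>
      obtain ⟨b, hb, h⟩ := hx
      obtain ⟨b', hb', h'⟩ := hy
      refine ⟨b + b', SetLike.mul_mem_graded hb hb', ?_⟩
      rcases h with h | h
      · exact .inl (J.mul_mem_right _ h)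
      rcases h' with h' | h'
      · exact .inl (J.mul_mem_left _ h')
      · exact .inr (by rw [map_add, h, h', add_zero])
  have hall : ∀ x ∈ Submodule.span A (Submonoid.closure s : Set R), GradedRing.proj 𝓡 c x ∈ J := by
    intro x hx
    induction hx using Submodule.span_induction with
    | mem x hx =>
      obtain ⟨b, hb, h⟩ := hmon x hx
      rw [GradedRing.proj_apply]
      by_cases hbc : b = c
      · subst hbc
        rw [DirectSum.decompose_of_mem_same 𝓡 hb]
        exact h.resolve_right hc
      · rw [DirectSum.decompose_of_mem_ne 𝓡 hb hbc]
        exact zero_mem J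
    | zero => rw [map_zero]; exact zero_mem J
    | add x y _ _ hx hy => rw [map_add]; exact add_mem hx hy
    | smul t x _ hx =>
      have h : GradedRing.proj 𝓡 c (t • x) = t • GradedRing.proj 𝓡 c x := by
        simp only [GradedRing.proj_apply, DirectSum.decompose_smul, DirectSum.smul_apply,
          Submodule.coe_smul]
      rw [h, Algebra.smul_def]
      exact J.mul_mem_left _ hx
  have htop : r ∈ Submodule.span A (Submonoid.closure s : Set R) := by
    rw [← Algebra.adjoin_eq_span, hs]
    trivial
  have := hall r htop
  rwa [GradedRing.proj_apply, DirectSum.decompose_of_mem_same 𝓡 hr] at this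

end Generators

section Staircase

variable {V : ℕ → ℤ × ℤ → Prop} {p p' : ℤ}

theorem mem_staircaseAt {i x y : ℤ} : (x, y) ∈ staircaseAt i (p, p') ↔
    (x - p, y - p') ∈ staircase i := by
  rw [staircaseAt, Set.mem_vadd_set_iff_neg_vadd_mem]
  have : -(p, p') +ᵥ (x, y) = (x - p, y - p') := by
    ext <;> simp <;> ring
  rw [this]

/-- The combinatorics of the staircases: a family of vanishing statements that propagates along
the Koszul complexes in both directions holds on the regions as soon as it holds on the
staircases. -/
theorem regRegion_of_staircaseAt
    (h₁ : ∀ i k k', (∀ j : ℕ, V (i + 1 + j) (k - j, k')) → V (i + 1) (k + 1, k'))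
    (h₂ : ∀ i k k', (∀ j : ℕ, V (i + 1 + j) (k, k' - j)) → V (i + 1) (k, k' + 1))
    (h : ∀ i : ℕ, 1 ≤ i → ∀ k ∈ staircaseAt ((i : ℤ) - 1) (p, p'), V i k) (i : ℕ) (hi : 1 ≤ i)
    (k : ℤ × ℤ) (hk : k ∈ regRegion ((i : ℤ) - 1) (p, p')) : V i k := by
  -- steps in the first direction, then in the second one, above the points of the staircases
  have hA : ∀ e : ℕ, ∀ i : ℕ, ∀ r s : ℤ, r < 0 → s < 0 → r + s = -(i + 2) →
      V (i + 2) (p + r + e, p' + s) := by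
    intro e
    induction e with
    | zero =>
      intro i r s hr hs hrs
      refine h _ (by lia) _ (mem_staircaseAt.2 ?_)
      rw [staircase, if_pos (by push_cast; lia)]
      refine ⟨?_, ?_, ?_⟩ <;> push_cast <;> lia
    | succ e ih =>
      intro i r s hr hs hrs
      have := h₁ (i + 1) (p + r + e) (p' + s) fun j => by
        have := ih (i + j) (r - j) s (by lia) hs (by push_cast; lia)
        rwa [show i + 1 + 1 + j = i + j + 2 by lia,
          show p + r + e - j = p + (r - j) + e by lia]
      rwa [show p + r + ((e + 1 : ℕ) : ℤ) = p + r + e + 1 by push_cast; lia]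
  have hB : ∀ f e : ℕ, ∀ i : ℕ, ∀ r s : ℤ, r < 0 → s < 0 → r + s = -(i + 2) →
      V (i + 2) (p + r + e, p' + s + f) := by
    intro f e
    induction f with
    | zero => simpa using hA e
    | succ f ih =>
      intro i r s hr hs hrs
      have := h₂ (i + 1) (p + r + e) (p' + s + f) fun j => by
        have := ih (i + j) r (s - j) hr (by lia) (by push_cast; lia)
        rwa [show i + 1 + 1 + j = i + j + 2 by lia,
          show p' + s + f - j = p' + (s - j) + f by lia]
      rwa [show p' + s + ((f + 1 : ℕ) : ℤ) = p' + s + f + 1 by push_cast; lia]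
  have hB' : ∀ i : ℕ, ∀ x y r s : ℤ, r < 0 → s < 0 → r + s = -(i + 2) → p + r ≤ x → p' + s ≤ y →
      V (i + 2) (x, y) := by
    intro i x y r s hr hs hrs hx hy
    have := hB (y - (p' + s)).toNat (x - (p + r)).toNat i r s hr hs hrs
    rwa [Int.toNat_of_nonneg (by lia), Int.toNat_of_nonneg (by lia), add_sub_cancel,
      add_sub_cancel] at this
  -- in cohomological degree `1` the terms with `j > 0` are covered by the higher degrees
  have hC : ∀ e : ℕ, V 1 (p + e, p') := by
    intro e
    induction e with
    | zero =>
      refine h 1 le_rfl _ (mem_staircaseAt.2 ?_)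
      rw [staircase, if_neg (by simp)]
      simp
    | succ e ih =>
      have := h₁ 0 (p + e) p' fun j => by
        cases j with
        | zero => simpa using ih
        | succ j =>
          rw [show 0 + 1 + (j + 1) = j + 2 by lia]
          exact hB' j _ _ (-(j + 1)) (-1) (by lia) (by lia) (by lia) (by push_cast; lia) (by lia)
      rwa [show p + ((e + 1 : ℕ) : ℤ) = p + e + 1 by push_cast; lia]
  have hD : ∀ f e : ℕ, V 1 (p + e, p' + f) := by
    intro f e
    induction f with
    | zero => simpa using hC e
    | succ f ih =>
      have := h₂ 0 (p + e) (p' + f) fun j => by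
        cases j with
        | zero => simpa using ih
        | succ j =>
          rw [show 0 + 1 + (j + 1) = j + 2 by lia]
          exact hB' j _ _ (-1) (-(j + 1)) (by lia) (by lia) (by lia) (by lia) (by push_cast; lia)
      rwa [show p' + ((f + 1 : ℕ) : ℤ) = p' + f + 1 by push_cast; lia]
  rw [regRegion, if_pos (by lia)] at hk
  obtain ⟨⟨u, w⟩, ⟨hu, hw⟩, ⟨x, y⟩, hxy, rfl⟩ := hk
  rw [mem_staircaseAt, staircase] at hxy
  change 0 ≤ u at hu
  change 0 ≤ w at hw
  change V i (u + x, w + y)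
  obtain rfl | hi := hi.eq_or_lt
  · rw [if_neg (by simp)] at hxy
    obtain ⟨hs, hx, hy⟩ := hxy
    simp only [] at hs hx hy
    have := hD (w + y - p').toNat (u + x - p).toNat
    rwa [Int.toNat_of_nonneg (by lia), Int.toNat_of_nonneg (by lia), add_sub_cancel,
      add_sub_cancel] at this
  · obtain ⟨i, rfl⟩ := Nat.exists_eq_add_of_le' hi
    rw [if_pos (by push_cast; lia)] at hxy
    obtain ⟨hs, hx, hy⟩ := hxy
    simp only [] at hs hx hy
    push_cast at hs
    exact hB' i _ _ (x - p) (y - p') hx hy (by lia) (by lia) (by lia)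

/-- Going back `j` steps in one direction from a point of the quadrant above `(p,p')` leads into the
region that belongs to the cohomological degree `1 + j`. -/
theorem mem_regRegion_of_neg {x y : ℤ} (j : ℕ)
    (hxy : (p ≤ x + j ∧ p' ≤ y) ∨ (p ≤ x ∧ p' ≤ y + j)) :
    (x, y) ∈ regRegion (((1 + j : ℕ) : ℤ) - 1) (p, p') := by
  rw [regRegion, if_pos (by push_cast; lia)]
  suffices h : ∃ r s, (r, s) ∈ staircase (((1 + j : ℕ) : ℤ) - 1) ∧ p + r ≤ x ∧ p' + s ≤ y by
    obtain ⟨r, s, hrs, hx, hy⟩ := h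
    refine ⟨(x - (p + r), y - (p' + s)), ⟨sub_nonneg.2 hx, sub_nonneg.2 hy⟩, (p + r, p' + s),
      mem_staircaseAt.2 (by simpa using hrs), by simp⟩
  obtain rfl | hj := Nat.eq_zero_or_pos j
  · refine ⟨0, 0, ?_, by lia, by lia⟩
    rw [staircase, if_neg (by simp)]
    simp
  · rw [staircase, if_pos (by push_cast; lia)]
    rcases hxy with ⟨hx, hy⟩ | ⟨hx, hy⟩
    · exact ⟨-j, -1, ⟨by push_cast; lia, by simpa using hj, by simp⟩, by lia, by lia⟩
    · exact ⟨-1, -j, ⟨by push_cast; lia, by simp, by simpa using hj⟩, by lia, by lia⟩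

end Staircase

/-! ### Bihomogeneous algebras -/

section PieceMul

variable {A : Type v} {R M : Type u} [CommRing A] [CommRing R] [Algebra A R]
  {𝓡 : ℤ × ℤ → Submodule A R} [GradedAlgebra 𝓡] [AddCommGroup M] [Module R M]
  {𝓜 : ℤ × ℤ → AddSubgroup M} [DirectSum.Decomposition 𝓜] [SetLike.GradedSMul 𝓡 𝓜]

theorem pieceMul_le (a k : ℤ × ℤ) : pieceMul 𝓡 𝓜 a k ≤ 𝓜 (a + k) := by
  refine (AddSubgroup.closure_le _).2 ?_
  rintro _ ⟨r, hr, m, hm, rfl⟩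
  exact SetLike.GradedSMul.smul_mem hr hm

theorem piece_le_pieceMul_zero (k : ℤ × ℤ) : 𝓜 k ≤ pieceMul 𝓡 𝓜 0 k := fun m hm =>
  AddSubgroup.subset_closure ⟨1, SetLike.one_mem_graded 𝓡, m, hm, one_smul R m⟩

theorem piece_le_pieceMul_add {a b k k' l : ℤ × ℤ} (h : 𝓜 l ≤ pieceMul 𝓡 𝓜 b k')
    (h' : 𝓜 k' ≤ pieceMul 𝓡 𝓜 a k) : 𝓜 l ≤ pieceMul 𝓡 𝓜 (a + b) k := by
  refine h.trans ((AddSubgroup.closure_le _).2 ?_)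
  rintro _ ⟨r, hr, m, hm, rfl⟩
  have hle : pieceMul 𝓡 𝓜 a k ≤
      (pieceMul 𝓡 𝓜 (a + b) k).comap (DistribSMul.toAddMonoidHom M r) := by
    refine (AddSubgroup.closure_le _).2 ?_
    rintro _ ⟨t, ht, n, hn, rfl⟩
    refine AddSubgroup.subset_closure ⟨t * r, SetLike.mul_mem_graded ht hr, n, hn, ?_⟩
    rw [mul_comm, mul_smul]
    rfl
  exact hle (h' hm)

theorem piece_le_pieceMul_nsmul {a k : ℤ × ℤ}
    (h : ∀ n : ℕ, 𝓜 (k + n • a + a) ≤ pieceMul 𝓡 𝓜 a (k + n • a)) (n : ℕ) :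
    𝓜 (k + n • a) ≤ pieceMul 𝓡 𝓜 (n • a) k := by
  induction n with
  | zero => simpa using piece_le_pieceMul_zero (𝓡 := 𝓡) (𝓜 := 𝓜) k
  | succ n ih =>
    rw [succ_nsmul, ← add_assoc]
    exact piece_le_pieceMul_add (h n) ih

end PieceMul

section Bihomogeneous

variable {A : Type v} {R M : Type u} [CommRing A] [CommRing R] [Algebra A R]
  {𝓡 : ℤ × ℤ → Submodule A R} [GradedAlgebra 𝓡]

theorem IsBihomogeneousAlgebra.isNoetherianRing [IsNoetherianRing A]
    (hR : IsBihomogeneousAlgebra 𝓡) : IsNoetherianRing R := by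
  obtain ⟨s, -, hs⟩ := hR.exists_generators
  have : Algebra.FiniteType A R := ⟨⟨s, hs⟩⟩
  exact Algebra.FiniteType.isNoetherianRing A R

theorem IsBihomogeneousAlgebra.exists_generators_fst (hR : IsBihomogeneousAlgebra 𝓡) :
    ∃ l : List R, (∀ r ∈ l, r ∈ 𝓡 (1, 0)) ∧ irrelevantIdeal 𝓡 ≤ Ideal.span {r | r ∈ l} := by
  classical
  obtain ⟨s, hdeg, hs⟩ := hR.exists_generators
  refine ⟨(s.filter fun r => r ∈ 𝓡 (1, 0)).toList, by simp, Ideal.span_le.2 ?_⟩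
  rintro r ⟨a, b, ha, -, hr⟩
  have := mem_span_of_generators hs (AddMonoidHom.fst ℤ ℤ)
    (fun x hx => (hdeg x hx).imp_right fun h => ⟨_, rfl, h⟩) (c := (a, b)) ha.ne' hr
  simpa using this

theorem IsBihomogeneousAlgebra.exists_generators_snd (hR : IsBihomogeneousAlgebra 𝓡) :
    ∃ l : List R, (∀ r ∈ l, r ∈ 𝓡 (0, 1)) ∧ irrelevantIdeal 𝓡 ≤ Ideal.span {r | r ∈ l} := by
  classical
  obtain ⟨s, hdeg, hs⟩ := hR.exists_generators
  refine ⟨(s.filter fun r => r ∈ 𝓡 (0, 1)).toList, by simp, Ideal.span_le.2 ?_⟩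
  rintro r ⟨a, b, -, hb, hr⟩
  have := mem_span_of_generators hs (AddMonoidHom.snd ℤ ℤ)
    (fun x hx => (hdeg x hx).symm.imp_right fun h => ⟨_, rfl, h⟩) (c := (a, b)) hb.ne' hr
  simpa using this

variable [IsNoetherianRing A] (hR : IsBihomogeneousAlgebra 𝓡) [AddCommGroup M] [Module R M]
  {𝓜 : ℤ × ℤ → AddSubgroup M} [DirectSum.Decomposition 𝓜] [SetLike.GradedSMul 𝓡 𝓜] {p p' : ℤ}

include hR

theorem vanishes_on_regRegion
    (h : ∀ i : ℕ, 1 ≤ i → ∀ k ∈ staircaseAt ((i : ℤ) - 1) (p, p'),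
      Subsingleton (bigradedLocalCohomology 𝓡 𝓜 i k)) :
    ∀ i : ℕ, 1 ≤ i → ∀ k ∈ regRegion ((i : ℤ) - 1) (p, p'),
      Subsingleton (bigradedLocalCohomology 𝓡 𝓜 i k) := by
  have := hR.isNoetherianRing
  refine regRegion_of_staircaseAt (V := fun i k =>
    Subsingleton (bigradedLocalCohomology 𝓡 𝓜 i k)) (fun i k k' hj => ?_) (fun i k k' hj => ?_) h
  · obtain ⟨l, hl, hIl⟩ := hR.exists_generators_fst
    have := localCohomologyVanishes_add (hI := irrelevantIdeal_isHomogeneous 𝓡) hl hIl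
      (bigradedModule 𝓡 𝓜) i (k, k') fun j => by
        have e : ((k, k') - j • (1, 0) : ℤ × ℤ) = (k - j, k') := by ext <;> simp
        rw [e]
        exact hj j
    rwa [Prod.mk_add_mk, add_zero] at this
  · obtain ⟨l, hl, hIl⟩ := hR.exists_generators_snd
    have := localCohomologyVanishes_add (hI := irrelevantIdeal_isHomogeneous 𝓡) hl hIl
      (bigradedModule 𝓡 𝓜) i (k, k') fun j => by
        have e : ((k, k') - j • (0, 1) : ℤ × ℤ) = (k, k' - j) := by ext <;> simp
        rw [e]
        exact hj j
    rwa [Prod.mk_add_mk, add_zero] at this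

theorem piece_le_pieceMul_of_vanishes {a k : ℤ × ℤ} {l : List R} (hl : ∀ r ∈ l, r ∈ 𝓡 a)
    (hIl : irrelevantIdeal 𝓡 ≤ Ideal.span {r | r ∈ l})
    (h₀ : Subsingleton (bigradedLocalCohomology 𝓡 𝓜 0 (k + a)))
    (h : ∀ j : ℕ, Subsingleton (bigradedLocalCohomology 𝓡 𝓜 (1 + j) (k - j • a))) :
    𝓜 (k + a) ≤ pieceMul 𝓡 𝓜 a k := by
  have := hR.isNoetherianRing
  intro x hx
  refine AddSubgroup.closure_mono ?_ (mem_closure_of_vanishes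
    (hI := irrelevantIdeal_isHomogeneous 𝓡) hl hIl (bigradedModule 𝓡 𝓜) k h₀ h x hx)
  rintro _ ⟨r, hr, m, hm, rfl⟩
  exact ⟨r, hl r hr, m, hm, rfl⟩

variable (h : ∀ i : ℕ, 1 ≤ i → ∀ k ∈ regRegion ((i : ℤ) - 1) (p, p'),
  Subsingleton (bigradedLocalCohomology 𝓡 𝓜 i k))

include h

theorem pieceMul_fst_eq
    (h₀ : ∀ k ∈ regRegion' (p, p'), Subsingleton (bigradedLocalCohomology 𝓡 𝓜 0 k))
    (d k k' : ℤ) (hd : 0 ≤ d) (hk : p ≤ k) (hk' : p' ≤ k') :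
    pieceMul 𝓡 𝓜 (d, 0) (k, k') = 𝓜 (d + k, k') := by
  obtain ⟨l, hl, hIl⟩ := hR.exists_generators_fst
  lift d to ℕ using hd
  refine le_antisymm (by simpa using pieceMul_le (𝓡 := 𝓡) (𝓜 := 𝓜) (d, 0) (k, k')) ?_
  have := piece_le_pieceMul_nsmul (𝓡 := 𝓡) (𝓜 := 𝓜) (a := (1, 0)) (k := (k, k')) (fun n => by
    have e : ((k, k') + n • (1, 0) : ℤ × ℤ) = (k + n, k') := by ext <;> simp
    rw [e]
    refine piece_le_pieceMul_of_vanishes hR hl hIl (h₀ _ ⟨_, rfl, (k + n - p, k' - p'),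
      ⟨?_, ?_⟩, ?_⟩) fun j => ?_
    · change 0 ≤ k + n - p
      lia
    · change 0 ≤ k' - p'
      lia
    · ext <;> simp; ring
    · have e' : ((k + n, k') - j • (1, 0) : ℤ × ℤ) = (k + n - j, k') := by ext <;> simp
      rw [e']
      exact h _ (by lia) _ (mem_regRegion_of_neg j (.inl ⟨by lia, hk'⟩))) d
  simpa [add_comm k] using this

theorem pieceMul_snd_eq
    (h₀ : ∀ k ∈ regRegion'' (p, p'), Subsingleton (bigradedLocalCohomology 𝓡 𝓜 0 k))
    (d k k' : ℤ) (hd : 0 ≤ d) (hk : p ≤ k) (hk' : p' ≤ k') :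
    pieceMul 𝓡 𝓜 (0, d) (k, k') = 𝓜 (k, k' + d) := by
  obtain ⟨l, hl, hIl⟩ := hR.exists_generators_snd
  lift d to ℕ using hd
  refine le_antisymm
    (by simpa [add_comm k'] using pieceMul_le (𝓡 := 𝓡) (𝓜 := 𝓜) (0, d) (k, k')) ?_
  have := piece_le_pieceMul_nsmul (𝓡 := 𝓡) (𝓜 := 𝓜) (a := (0, 1)) (k := (k, k')) (fun n => by
    have e : ((k, k') + n • (0, 1) : ℤ × ℤ) = (k, k' + n) := by ext <;> simp
    rw [e]
    refine piece_le_pieceMul_of_vanishes hR hl hIl (h₀ _ ⟨_, rfl, (k - p, k' + n - p'),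
      ⟨?_, ?_⟩, ?_⟩) fun j => ?_
    · change 0 ≤ k - p
      lia
    · change 0 ≤ k' + n - p'
      lia
    · ext <;> simp; ring
    · have e' : ((k, k' + n) - j • (0, 1) : ℤ × ℤ) = (k, k' + n - j) := by ext <;> simp
      rw [e']
      exact h _ (by lia) _ (mem_regRegion_of_neg j (.inr ⟨hk, by lia⟩))) d
  simpa using this

end Bihomogeneous

end

theorem theoremT {A : Type v} {R M : Type u} [CommRing A] [IsNoetherianRing A] [CommRing R]
    [Algebra A R] (𝓡 : ℤ × ℤ → Submodule A R) [GradedAlgebra 𝓡]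
    (hR : IsBihomogeneousAlgebra 𝓡) [AddCommGroup M] [Module R M] [Module.Finite R M]
    (𝓜 : ℤ × ℤ → AddSubgroup M) [DirectSum.Decomposition 𝓜] [SetLike.GradedSMul 𝓡 𝓜]
    (p p' : ℤ) :
    ((∀ i : ℕ, 1 ≤ i → ∀ k ∈ staircaseAt ((i : ℤ) - 1) (p, p'),
        Subsingleton (bigradedLocalCohomology 𝓡 𝓜 i k)) →
      (∀ i : ℕ, 1 ≤ i → ∀ k ∈ regRegion ((i : ℤ) - 1) (p, p'),
        Subsingleton (bigradedLocalCohomology 𝓡 𝓜 i k)) ∧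
      ((∀ k ∈ regRegion' (p, p'), Subsingleton (bigradedLocalCohomology 𝓡 𝓜 0 k)) →
        ∀ d k k' : ℤ, 0 ≤ d → p ≤ k → p' ≤ k' →
          pieceMul 𝓡 𝓜 (d, 0) (k, k') = 𝓜 (d + k, k')) ∧
      ((∀ k ∈ regRegion'' (p, p'), Subsingleton (bigradedLocalCohomology 𝓡 𝓜 0 k)) →
        ∀ d' k k' : ℤ, 0 ≤ d' → p ≤ k → p' ≤ k' →
          pieceMul 𝓡 𝓜 (0, d') (k, k') = 𝓜 (k, k' + d'))) ∧
    (IsWeaklyRegular 𝓡 𝓜 (p, p') →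
      (∀ k ∈ regRegion' (p, p') ∪ regRegion'' (p, p'),
        Subsingleton (bigradedLocalCohomology 𝓡 𝓜 0 k)) →
      ∀ d d' k k' : ℤ, 0 ≤ d → 0 ≤ d' → p ≤ k → p' ≤ k' →
        pieceMul 𝓡 𝓜 (d, d') (k, k') = 𝓜 (k + d, k' + d')) := by
  refine ⟨fun h => ?_, fun h h₀ d d' k k' hd hd' hk hk' => ?_⟩
  · have hreg := vanishes_on_regRegion hR h
    exact ⟨hreg, pieceMul_fst_eq hR hreg, pieceMul_snd_eq hR hreg⟩
  · have hreg : ∀ i : ℕ, 1 ≤ i → ∀ k ∈ regRegion ((i : ℤ) - 1) (p, p'),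
        Subsingleton (bigradedLocalCohomology 𝓡 𝓜 i k) := fun i _ => h i
    have h₁ := pieceMul_fst_eq hR hreg (fun q hq => h₀ q (.inl hq)) d k (k' + d') hd hk (by lia)
    have h₂ := pieceMul_snd_eq hR hreg (fun q hq => h₀ q (.inr hq)) d' k k' hd' hk hk'
    refine le_antisymm
      (by simpa [add_comm] using pieceMul_le (𝓡 := 𝓡) (𝓜 := 𝓜) (d, d') (k, k')) ?_
    have := piece_le_pieceMul_add h₁.ge h₂.ge
    simpa [add_comm d k] using this
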